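/- **Conventions.** Let $\mathbb Z(2)$ be the additive group of integers modulo $2$. $\mathrm M^1(A)$ denotes the set of Borel probability distributions on a locally compact Abelian group $A$, $*$ denotes convolution, and $E_x$ is the distribution concentrated at the point $x$. For $\mu\in \mathrm M^1(A)$ the characteristic function is $\hat\mu(y)=\int_A (x,y)\,d\mu(x)$, where $y$ runs over the (continuous unitary) characters of $A$. A distribution on a closed subgroup is also regarded as a distribution on the whole group. The conditional distribution of $L_2$ given $L_1$ is called symmetric if, for almost every value $x$ of $L_1$, the conditional distribution of $L_2$ given $L_1=x$ is invariant under $y\mapsto -y$. A distribution $\mu\in \mathrm M^1(\mathbb R\times\mathbb Z(2))$ belongs to the class $\Theta$ if there are real numbers $\sigma\ge 0$, $\sigma'\ge 0$, $\mathfrak m$, $\mathfrak m'$, $\varkappa$ such that, for all $s\in\mathbb R$, $$\hat\mu(s,0)=\exp\{-\sigma s^2+i\mathfrak m s\},\qquad \hat\mu(s,1)=\varkappa\exp\{-\sigma' s^2+i\mathfrak m' s\},$$ where the character $(s,n)$ is $(t,m)\mapsto e^{its}(-1)^{mn}$, and either $$0<\sigma'<\sigma,\qquad 0<|\varkappa|\le\sqrt{\frac{\sigma'}{\sigma}}\,\exp\Big\{-\frac{(\mathfrak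 m-\mathfrak m')^2}{4(\sigma-\sigma')}\Big\},$$ or $\sigma=\sigma'$, $\mathfrak m=\mathfrak m'$, $|\varkappa|\le 1$. **Theorem.** Let $X=\mathbb R\times\mathbb Z(2)\times G$, where $G$ is a finite Abelian group containing no elements of order $2$. Let $\alpha=(a,I,\alpha_G)$ be a topological automorphism of $X$, that is, $\alpha(t,m,g)=(at,m,\alpha_G g)$ with $a\in\mathbb R$, $a\neq 0$, and $\alpha_G$ an automorphism of $G$. Put $K=\mathrm{Ker}(I+\alpha_G)$. Let $\xi_1,\xi_2$ be independent random variables with values in $X$ and distributions $\mu_1,\mu_2$ whose characteristic functions do not vanish. Assume that the conditional distribution of $L_2=\xi_1+\alpha\xi_2$ given $L_1=\xi_1+\xi_2$ is symmetric. Then the following statements are true. I. If $a\neq -1$, then $\mu_j=\gamma_j*\omega_j*E_{g_j}$, $j=1,2$, where $\gamma_j$ are distributions of the class $\Theta$ on the subgroup $\mathbb R\times\mathbb Z(2)$, $\omega_j$ are distributions on the subgroup $\mathbb Z(2)\times K$, $g_j\in G$, and either $\omega_1=\omega_2*\vartheta_2$ for some $\vartheta_2\in \mathrm M^1(\mathbb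 Z(2))$ or $\omega_2=\omega_1*\vartheta_1$ for some $\vartheta_1\in \mathrm M^1(\mathbb Z(2))$. II. If $a=-1$, then $\mu_j=\omega_j*E_{x_j}$, $j=1,2$, where $\omega_j$ are distributions on the subgroup $\mathbb R\times\mathbb Z(2)\times K$, $x_j\in X$, and either $\omega_1=\omega_2*\vartheta_2$ for some $\vartheta_2\in \mathrm M^1(\mathbb Z(2))$ or $\omega_2=\omega_1*\vartheta_1$ for some $\vartheta_1\in \mathrm M^1(\mathbb Z(2))$. -/

import Mathlib

open MeasureTheory ProbabilityTheory

namespace HeydeLCA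

/-- The characteristic function `μ̂(χ) = ∫ χ(x) dμ(x)` of a measure `μ` on an additive group,
evaluated at a character `χ`. -/
noncomputable def charFn {X : Type*} [AddCommGroup X] [MeasurableSpace X]
    (μ : Measure X) (χ : AddChar X Circle) : ℂ :=
  ∫ x, (χ x : ℂ) ∂μ

/-- The characteristic function of `μ` does not vanish at any point of the character group of `X`,
i.e. at any continuous homomorphism from `X` to the circle group. -/
def NonvanishingCharFn {X : Type*} [AddCommGroup X] [TopologicalSpace X] [MeasurableSpace X]
    (μ : Measure X) : Prop :=
  ∀ χ : AddChar X Circle, Continuous χ → charFn μ χ ≠ 0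

/-- The conditional distribution of `L₂` given `L₁` is symmetric: for almost every value `x` of
`L₁`, the conditional law of `L₂` given `L₁ = x` is invariant under `y ↦ -y`. -/
def CondDistribSymmetric {Ω X : Type*} [MeasurableSpace Ω] [AddCommGroup X] [MeasurableSpace X]
    [StandardBorelSpace X] (L₂ L₁ : Ω → X) (P : Measure Ω) [IsFiniteMeasure P] : Prop :=
  ∀ᵐ x ∂(P.map L₁),
    (condDistrib L₂ L₁ P x).map (fun y => -y) = condDistrib L₂ L₁ P x

/-- The character `(t, m) ↦ e^{its} (-1)^{mn}` of `ℝ × ℤ(2)` indexed by `(s, n)`. Every continuous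
character of `ℝ × ℤ(2)` is of this form. -/
noncomputable def charRZ2 (s : ℝ) (n : ZMod 2) : AddChar (ℝ × ZMod 2) Circle where
  toFun x := Circle.exp (x.1 * s) * ZMod.toCircle (x.2 * n)
  map_zero_eq_one' := by simp
  map_add_eq_mul' x y := by
    simp only [Prod.fst_add, Prod.snd_add, add_mul, Circle.exp_add, AddChar.map_add_eq_mul]
    exact mul_mul_mul_comm _ _ _ _

/-- The class `Θ` of probability distributions on `ℝ × ℤ(2)`. -/
def ClassTheta (μ : Measure (ℝ × ZMod 2)) : Prop :=
  IsProbabilityMeasure μ ∧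
    ∃ σ σ' m m' κ : ℝ, 0 ≤ σ ∧ 0 ≤ σ' ∧
      (∀ s : ℝ, charFn μ (charRZ2 s 0) = Complex.exp (-σ * s ^ 2 + Complex.I * m * s)) ∧
      (∀ s : ℝ, charFn μ (charRZ2 s 1) = κ * Complex.exp (-σ' * s ^ 2 + Complex.I * m' * s)) ∧
      ((0 < σ' ∧ σ' < σ ∧ 0 < |κ| ∧
          |κ| ≤ Real.sqrt (σ' / σ) * Real.exp (-((m - m') ^ 2 / (4 * (σ - σ'))))) ∨
        (σ = σ' ∧ m = m' ∧ |κ| ≤ 1))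

/-- The subgroup `Ker (I + β)` of `G`. -/
def kerIdAdd {G : Type*} [AddCommGroup G] (β : G ≃+ G) : AddSubgroup G :=
  (AddMonoidHom.id G + β.toAddMonoidHom).ker

/-- `μ` as a distribution on `ℝ × ℤ(2) × G`, for `μ` a distribution on the subgroup
`ℝ × ℤ(2)`. -/
noncomputable def ofRZ2 (G : Type*) [AddCommGroup G] [MeasurableSpace G]
    (μ : Measure (ℝ × ZMod 2)) : Measure (ℝ × ZMod 2 × G) :=
  μ.map (fun x => (x.1, x.2, (0 : G)))

/-- `μ` as a distribution on `ℝ × ℤ(2) × G`, for `μ` a distribution on the subgroup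
`ℤ(2) × K`. -/
noncomputable def ofZ2K {G : Type*} [AddCommGroup G] [MeasurableSpace G] {K : AddSubgroup G}
    (μ : Measure (ZMod 2 × K)) : Measure (ℝ × ZMod 2 × G) :=
  μ.map (fun x => ((0 : ℝ), x.1, (x.2 : G)))

/-- `μ` as a distribution on `ℝ × ℤ(2) × G`, for `μ` a distribution on the subgroup
`ℝ × ℤ(2) × K`. -/
noncomputable def ofRZ2K {G : Type*} [AddCommGroup G] [MeasurableSpace G] {K : AddSubgroup G}
    (μ : Measure (ℝ × ZMod 2 × K)) : Measure (ℝ × ZMod 2 × G) :=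
  μ.map (fun x => (x.1, x.2.1, (x.2.2 : G)))

/-- Either `ω₁ = ω₂ * ϑ` or `ω₂ = ω₁ * ϑ` for some probability distribution `ϑ` on `ℤ(2)`, where
`ϑ` is regarded as a distribution on `A` through the embedding `i` of `ℤ(2)` in `A`. -/
def Z2Related {A : Type*} [AddCommGroup A] [MeasurableSpace A] (i : ZMod 2 → A)
    (ω₁ ω₂ : Measure A) : Prop :=
  (∃ ϑ₂ : Measure (ZMod 2), IsProbabilityMeasure ϑ₂ ∧ ω₁ = ω₂ ∗ ϑ₂.map i) ∨
    (∃ ϑ₁ : Measure (ZMod 2), IsProbabilityMeasure ϑ₁ ∧ ω₂ = ω₁ ∗ ϑ₁.map i)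

end HeydeLCA

/-! Write `f₁`, `f₂` for the characteristic functions. Symmetry means that `(L₁, L₂)` and `(L₁,
-L₂)` have the same law. By independence this becomes the Heyde equation `f₁(u + v) f₂(u + α̃v) =
f₁(u - v) f₂(u - α̃v)` on the dual group, `α̃` being the adjoint of `α` (`heydeEq_of_map_prod_eq`).

On the dual of `G` the functions `log |f_j|` are even, nonpositive and solve the additive form of
this equation. `vanish_of_heyde` then gives `|f_j| = 1` on the image of `I + α̃_G`, so `g + α_G g`
is almost surely constant under each `μ_j`. Translations preserving the equation therefore move both
distributions to `ℝ × ℤ(2) × K` (`exists_shift`). There `α_G = -I`, and since characters of `G` can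
be halved, the `G`-arguments become independent: `f₁(s+t,n,p) f₂(s+at,n,q) = f₁(s-t,n,q)
f₂(s-at,n,p)` (`HeydeEq.reduced`).

If `a = -1`, taking `s = t` and `q = 0` makes `f₁` and `f₂` proportional for each `n`, with factor
`1` for `n = 0` and a real factor for `n = 1`. That factor or its inverse has modulus at most `1`,
hence comes from a distribution on `ℤ(2)` (`z2Related_of_charFn`).

If `a ≠ -1`, the variables separate: `f_j(s,n,p) = f_j(s,n,0) c(n,p)` with the same `c` for both `j`
(`charFn_separate`), and Heyde's equation on the line makes `s ↦ f_j(s,n,0)` Gaussian up to a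
constant (`gaussian_form_of_reduced`). What remains is positivity: the constant at `n = 1` has to be
shared between `γ_j` and `ω` so that both are measures. Let the fibre of `μ₁` over `k ∈ G` have mass
`b_k` and difference `d_k` of its masses on the two lines. Choose `k₀` maximising `|d_k| / b_k`. The
normalised fibre of `μ_j` over `k₀` serves as `γ_j`, and maximality is exactly what makes `ω`
nonnegative (`exists_decomposition`). Membership of `γ_j` in `Θ` comes from domination of one
Gaussian by another (`classTheta_of_charFn`). -/

namespace HeydeLCA

/-! ### The additive Heyde equation on finite groups -/

/-- Third-difference equation satisfied by the first solution of the additive Heyde equation. -/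
lemma third_difference_fst {H V : Type*} [AddCommGroup H] [AddCommGroup V] (β : H →+ H)
    (A₁ A₂ : H → V)
    (h : ∀ u v, A₁ (u + v) + A₂ (u + β v) = A₁ (u - v) + A₂ (u - β v)) (x k l p : H) :
    A₁ (x + (k - β k) + 2 • l + (p + β p)) - A₁ (x + (k - β k) + 2 • l)
      - A₁ (x + (k - β k) + (p + β p)) - A₁ (x + 2 • l + (p + β p))
      + A₁ (x + (k - β k)) + A₁ (x + 2 • l) + A₁ (x + (p + β p)) - A₁ x = 0 := by
  -- Moving `(u, v)` by `(-βk, k)`, `(l, l)`, `(βp, p)` fixes `u + βv`, `u - v`, `u - βv`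
  -- respectively, and moves `u + v` by `k - βk`, `2l`, `p + βp`. The alternating sum over the three
  -- moves from `(x, 0)` thus cancels every term but `A₁(u + v)`. The instance at `(x, 0)` itself is
  -- trivial.
  have e1 := h (x - β k) k
  have e2 := h (x + l) l
  have e3 := h (x + β p) p
  have e12 := h (x - β k + l) (k + l)
  have e13 := h (x - β k + β p) (k + p)
  have e23 := h (x + l + β p) (l + p)
  have e123 := h (x - β k + l + β p) (k + l + p)
  simp only [map_add] at e1 e2 e3 e12 e13 e23 e123
  abel_nf at e1 e2 e3 e12 e13 e23 e123 ⊢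
  linear_combination (norm := skip) e123 - e12 - e13 - e23 + e1 + e2 + e3
  abel_nf

/-- On a finite group with surjective doubling, the first solution of the additive Heyde equation is
additive across `(1 - β) H` and `(1 + β) H`. -/
lemma additive_of_heyde_fst {H : Type*} [AddCommGroup H] [Finite H]
    (h2 : Function.Surjective fun x : H => 2 • x) (β : H →+ H) (A₁ A₂ : H → ℝ)
    (h : ∀ u v, A₁ (u + v) + A₂ (u + β v) = A₁ (u - v) + A₂ (u - β v))
    (h0 : A₁ 0 = 0) (k p : H) :
    A₁ ((k - β k) + (p + β p)) = A₁ (k - β k) + A₁ (p + β p) := by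
  have := Fintype.ofFinite H
  set D : H → ℝ := fun x =>
    A₁ (x + (k - β k) + (p + β p)) - A₁ (x + (k - β k)) - A₁ (x + (p + β p)) + A₁ x with hD
  -- The mixed second difference `D` is invariant under shifts by `2l`, which are all shifts. Being
  -- constant with zero sum over the group, it vanishes.
  have hconst : ∀ x, D x = D 0 := by
    intro x
    obtain ⟨l, rfl⟩ := h2 x
    have := third_difference_fst β A₁ A₂ h 0 k l p
    simp only [hD, zero_add] at this ⊢
    rw [add_comm (2 • l) (k - β k)]
    linarith
  have hsum : ∑ x, D x = 0 := by
    have key : ∀ c, ∑ x, A₁ (x + c) = ∑ x, A₁ x := fun c =>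
      Fintype.sum_equiv (Equiv.addRight c) _ _ fun _ => rfl
    simp only [hD, Finset.sum_add_distrib, Finset.sum_sub_distrib, add_assoc, key]
    ring
  rw [Finset.sum_congr rfl fun x _ => hconst x, Finset.sum_const, nsmul_eq_mul,
    mul_eq_zero] at hsum
  have hz : D 0 = 0 := hsum.resolve_left (by simp)
  simp only [hD, zero_add, h0] at hz
  linarith

/-- Nonpositive even solutions of the additive Heyde equation on a finite group with surjective
doubling vanish on `(1 + β) H`. -/
lemma vanish_of_heyde {H : Type*} [AddCommGroup H] [Finite H]
    (h2 : Function.Surjective fun x : H => 2 • x) (β : H ≃+ H) (A₁ A₂ : H → ℝ)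
    (h : ∀ u v, A₁ (u + v) + A₂ (u + β v) = A₁ (u - v) + A₂ (u - β v))
    (h01 : A₁ 0 = 0) (h02 : A₂ 0 = 0) (hn1 : ∀ x, A₁ x ≤ 0) (hn2 : ∀ x, A₂ x ≤ 0)
    (he1 : ∀ x, A₁ (-x) = A₁ x) (he2 : ∀ x, A₂ (-x) = A₂ x) (v : H) :
    A₁ (v + β v) = 0 ∧ A₂ (v + β v) = 0 := by
  have had1 := additive_of_heyde_fst h2 β.toAddMonoidHom A₁ A₂ h h01
  -- Substituting `β⁻¹v` for `v` exchanges the roles of `A₁` and `A₂`.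
  have had2 := additive_of_heyde_fst h2 β.symm.toAddMonoidHom A₂ A₁ (by
    intro u v
    have := h u (β.symm v)
    simp only [AddEquiv.apply_symm_apply] at this
    simp only [AddEquiv.toAddMonoidHom_eq_coe, AddMonoidHom.coe_coe]
    linarith) h02
  simp only [AddEquiv.toAddMonoidHom_eq_coe, AddMonoidHom.coe_coe] at had1 had2
  have hQ1 : A₁ (v - β v) = A₁ (v + β v) + A₂ (v + β v) + A₂ (v - β v) := by
    have e1 := h (β v) v
    have e2 := had2 (β v) (β v)
    simp only [AddEquiv.symm_apply_apply] at e2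
    rw [sub_self, h02, add_comm (β v) v, ← neg_sub v, he1] at e1
    have e3 : β v - v + (β v + v) = β v + β v := by abel
    rw [e3, ← neg_sub v, he2, add_comm (β v) v] at e2
    linarith
  have hQ2 : A₂ (v - β v) = A₂ (v + β v) + A₁ (v + β v) + A₁ (v - β v) := by
    have e1 := h v v
    have e2 := had1 v v
    rw [sub_self, h01] at e1
    have e3 : v - β v + (v + β v) = v + v := by abel
    rw [e3] at e2
    linarith
  -- Adding `hQ1` and `hQ2` gives `A₁(v + βv) + A₂(v + βv) = 0`, a sum of two nonpositive terms.
  constructor <;> linarith [hn1 (v + β v), hn2 (v + β v)]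

/-! ### The Heyde equation on the line -/

/-- A continuous nonvanishing function on the line has a continuous logarithm. -/
lemma exists_continuous_log (φ : ℝ → ℂ) (hφ : Continuous φ) (h0 : ∀ s, φ s ≠ 0) :
    ∃ ℓ : ℝ → ℂ, Continuous ℓ ∧ ∀ s, Complex.exp (ℓ s) = φ s := by
  obtain ⟨F, ⟨-, hF⟩, -⟩ := Complex.isCoveringMapOn_exp.existsUnique_continuousMap_lifts
    (⟨φ, hφ⟩ : C(ℝ, ℂ)) (a₀ := 0) (e₀ := Complex.log (φ 0)) (Complex.exp_log (h0 0)) h0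
  exact ⟨F, F.continuous, fun s => congrFun hF s⟩

/-- Two continuous logarithms of the same function which agree at `0` coincide. -/
lemma eq_of_exp_eq {F E : ℝ → ℂ} (hF : Continuous F) (hE : Continuous E)
    (h : ∀ s, Complex.exp (F s) = Complex.exp (E s)) (h0 : F 0 = E 0) : F = E := by
  obtain ⟨L, -, hL⟩ := Complex.isCoveringMapOn_exp.existsUnique_continuousMap_lifts
    (⟨fun s => Complex.exp (F s), by fun_prop⟩ : C(ℝ, ℂ)) (a₀ := 0) (e₀ := F 0) rfl
    (fun _ => Complex.exp_ne_zero _)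
  have h1 := hL ⟨F, hF⟩ ⟨rfl, rfl⟩
  have h2 := hL ⟨E, hE⟩ ⟨h0.symm, funext fun s => (h s).symm⟩
  exact congrArg DFunLike.coe (h1.trans h2.symm)

/-- A continuous additive function on the line is linear. -/
lemma exists_linear_of_additive (f : ℝ → ℂ) (hf : Continuous f)
    (hadd : ∀ x y, f (x + y) = f x + f y) : ∃ c : ℂ, ∀ x, f x = x * c := by
  refine ⟨f 1, fun x => ?_⟩
  have := map_real_smul (AddMonoidHom.mk' f hadd) hf x 1
  simpa using this

/-- A continuous function on the line with vanishing third differences is a quadratic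
polynomial. -/
lemma exists_quadratic (ℓ : ℝ → ℂ) (hℓ : Continuous ℓ)
    (h : ∀ x y z, ℓ (x + y + z) - ℓ (x + y) - ℓ (x + z) - ℓ (y + z) + ℓ x + ℓ y + ℓ z - ℓ 0 = 0) :
    ∃ c d : ℂ, ∀ s : ℝ, ℓ s = ℓ 0 + c * s ^ 2 + d * s := by
  set B : ℝ → ℝ → ℂ := fun x y => ℓ (x + y) - ℓ x - ℓ y + ℓ 0 with hB
  have hBadd : ∀ y x x', B (x + x') y = B x y + B x' y := by
    intro y x x'
    simp only [hB]
    linear_combination h x x' y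
  have hBsymm : ∀ x y, B x y = B y x := fun x y => by simp only [hB, add_comm x y]; ring
  have hB1 : ∀ x y, B x y = x * B 1 y := by
    intro x y
    obtain ⟨c, hc⟩ := exists_linear_of_additive (fun x => B x y) (by fun_prop) (hBadd y)
    have h1 := hc 1
    simp only [Complex.ofReal_one, one_mul] at h1
    rw [hc x, h1]
  have hB2 : ∀ x y, B x y = x * y * B 1 1 := by
    intro x y
    rw [hB1, hBsymm, hB1 y]; ring
  obtain ⟨d, hd⟩ := exists_linear_of_additive (fun x => ℓ x - ℓ 0 - B 1 1 / 2 * x ^ 2)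
    (by fun_prop) (by
      intro x y
      have := hB2 x y
      simp only [hB] at this ⊢
      push_cast
      linear_combination this)
  exact ⟨B 1 1 / 2, d, fun s => by linear_combination hd s⟩

/-- Bounded continuous nonvanishing Hermitian solutions of the multiplicative Heyde equation on the
line are of Gaussian type. -/
lemma gaussian_of_heyde {a : ℝ} (ha1 : a ≠ 1) (ha2 : a ≠ -1) {φ₁ φ₂ : ℝ → ℂ}
    (hc1 : Continuous φ₁) (hc2 : Continuous φ₂) (h1 : ∀ s, φ₁ s ≠ 0) (h2 : ∀ s, φ₂ s ≠ 0)
    (heq : ∀ s t, φ₁ (s + t) * φ₂ (s + a * t) = φ₁ (s - t) * φ₂ (s - a * t))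
    (hherm : ∀ s, φ₁ (-s) = (starRingEnd ℂ) (φ₁ s)) (hbd : ∀ s, ‖φ₁ s‖ ≤ 1) :
    ∃ σ m : ℝ, 0 ≤ σ ∧
      ∀ s : ℝ, φ₁ s = φ₁ 0 * Complex.exp (-σ * s ^ 2 + Complex.I * m * s) := by
  obtain ⟨ℓ₁, hℓ1, he1⟩ := exists_continuous_log φ₁ hc1 h1
  obtain ⟨ℓ₂, hℓ2, he2⟩ := exists_continuous_log φ₂ hc2 h2
  have hadd : ∀ s t, ℓ₁ (s + t) + ℓ₂ (s + a * t) = ℓ₁ (s - t) + ℓ₂ (s - a * t) := by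
    intro s t
    refine congrFun (eq_of_exp_eq (F := fun t => ℓ₁ (s + t) + ℓ₂ (s + a * t))
      (E := fun t => ℓ₁ (s - t) + ℓ₂ (s - a * t)) (by fun_prop) (by fun_prop) (fun t => ?_)
      (by simp)) t
    simp only [Complex.exp_add, he1, he2, heq]
  have h3 := third_difference_fst (AddMonoidHom.mulLeft a) ℓ₁ ℓ₂ hadd
  -- For `a ≠ ±1` the increments `k - ak`, `2l`, `p + ap` run over the whole line, so all third
  -- differences of `ℓ₁` vanish.
  obtain ⟨c, d, hq⟩ := exists_quadratic ℓ₁ hℓ1 (by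
    intro x y z
    have := h3 0 (x / (1 - a)) (y / 2) (z / (1 + a))
    have e1 : x / (1 - a) - a * (x / (1 - a)) = x := by
      have : 1 - a ≠ 0 := sub_ne_zero.2 ha1.symm
      field_simp
    have e2 : z / (1 + a) + a * (z / (1 + a)) = z := by
      have : 1 + a ≠ 0 := fun h => ha2 (by linarith)
      field_simp
    have e3 : 2 • (y / 2) = y := by rw [nsmul_eq_mul]; push_cast; ring
    simp only [AddMonoidHom.coe_mulLeft, e1, e2, e3, zero_add] at this
    exact this)
  have hφ : ∀ s : ℝ, φ₁ s = φ₁ 0 * Complex.exp (c * s ^ 2 + d * s) := by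
    intro s
    rw [← he1, ← he1, hq s, ← Complex.exp_add, add_assoc]
  have hreal : (starRingEnd ℂ) (φ₁ 0) = φ₁ 0 := by simpa using (hherm 0).symm
  have hconj : ∀ s : ℝ, Complex.exp (c * s ^ 2 - d * s) =
      Complex.exp ((starRingEnd ℂ) c * s ^ 2 + (starRingEnd ℂ) d * s) := by
    intro s
    have := hherm s
    rw [hφ s, hφ (-s), map_mul, hreal, ← Complex.exp_conj] at this
    have := mul_left_cancel₀ (h1 0) this
    simpa [sub_eq_add_neg] using this
  have hfun : ∀ s : ℝ, c * s ^ 2 - d * s = (starRingEnd ℂ) c * s ^ 2 + (starRingEnd ℂ) d * s :=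
    fun s => congrFun (eq_of_exp_eq (F := fun s : ℝ => c * s ^ 2 - d * s)
      (E := fun s : ℝ => (starRingEnd ℂ) c * s ^ 2 + (starRingEnd ℂ) d * s)
      (by fun_prop) (by fun_prop) hconj (by simp)) s
  have f1 := hfun 1
  have f2 := hfun (-1)
  have hcim : c.im = 0 := by
    have := congrArg Complex.im (show c * 2 = (starRingEnd ℂ) c * 2 by
      push_cast at f1 f2; linear_combination f1 + f2)
    simp at this
    linarith
  have hdre : d.re = 0 := by
    have := congrArg Complex.re (show -d * 2 = (starRingEnd ℂ) d * 2 by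
      push_cast at f1 f2; linear_combination f1 - f2)
    simp at this
    linarith
  refine ⟨-c.re, d.im, ?_, fun s => ?_⟩
  · by_contra hneg
    have hcpos : 0 < c.re := by linarith
    have hn : ∀ s : ℝ, ‖φ₁ 0‖ * Real.exp (c.re * s ^ 2) ≤ 1 := by
      intro s
      have := hbd s
      rw [hφ, norm_mul, Complex.norm_exp] at this
      simpa [hdre, ← Complex.ofReal_pow] using this
    have hp : 0 < ‖φ₁ 0‖ := norm_pos_iff.2 (h1 0)
    -- At this point the exponent is `1/‖φ₁ 0‖`, and `‖φ₁ 0‖ exp(1/‖φ₁ 0‖) > 1 + ‖φ₁ 0‖` contradicts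
    -- the bound.
    have := hn (Real.sqrt (1 / (c.re * ‖φ₁ 0‖)))
    rw [Real.sq_sqrt (by positivity)] at this
    have e : c.re * (1 / (c.re * ‖φ₁ 0‖)) = 1 / ‖φ₁ 0‖ := by field_simp
    rw [e] at this
    have h4 := Real.add_one_lt_exp (x := 1 / ‖φ₁ 0‖) (by positivity)
    have h5 : ‖φ₁ 0‖ * (1 / ‖φ₁ 0‖ + 1) = 1 + ‖φ₁ 0‖ := by field_simp
    nlinarith
  · rw [hφ s]
    have ec : c = c.re := by apply Complex.ext <;> simp [hcim]
    have ed : d = Complex.I * d.im := by apply Complex.ext <;> simp [hdre]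
    congr 2
    rw [ec, ed]; simp

/-! ### Domination between Gaussians and the class `Θ` -/

lemma toCircle_two_one : ((ZMod.toCircle (1 : ZMod 2) : Circle) : ℂ) = -1 := by
  rw [ZMod.toCircle_apply]
  have : (2 * Real.pi * Complex.I * ((1 : ZMod 2).val : ℂ) / ((2 : ℕ) : ℂ) : ℂ)
      = Real.pi * Complex.I := by
    rw [ZMod.val_one]; push_cast; ring
  rw [this, Complex.exp_pi_mul_I]

/-- Pointwise domination between exponentials of quadratic polynomials. -/
lemma gaussian_exponent_domination {σ σ' m m' κ : ℝ} (hσ : 0 < σ) (hσ' : 0 < σ') (hκ : 0 < κ)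
    (h : ∀ t, κ ≤ Real.sqrt (σ' / σ) *
      Real.exp ((t - m') ^ 2 / (4 * σ') - (t - m) ^ 2 / (4 * σ))) :
    (σ' < σ ∧ κ ≤ Real.sqrt (σ' / σ) * Real.exp (-((m - m') ^ 2 / (4 * (σ - σ'))))) ∨
      (σ = σ' ∧ m = m') := by
  rcases lt_or_ge σ' σ with hlt | hge
  -- This `t` minimises the exponent, whose minimum is `-(m - m')² / (4(σ - σ'))`.
  · refine Or.inl ⟨hlt, (h ((m' * σ - m * σ') / (σ - σ'))).trans_eq ?_⟩
    have hd : σ - σ' ≠ 0 := by linarith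
    congr 2
    field_simp
    ring
  · have hs : 0 < Real.sqrt (σ' / σ) := by positivity
    obtain ⟨C, hC⟩ : ∃ C, ∀ t, C ≤ (t - m') ^ 2 / (4 * σ') - (t - m) ^ 2 / (4 * σ) := by
      refine ⟨Real.log (κ / Real.sqrt (σ' / σ)), fun t => ?_⟩
      rw [Real.log_le_iff_le_exp (by positivity), div_le_iff₀ hs, mul_comm]
      exact h t
    -- A quadratic polynomial in `x = t - m` that is bounded below: its leading coefficient cannot
    -- be negative, and once that coefficient is zero the linear one must vanish too.
    have hD : ∀ x, 4 * σ * σ' * C ≤ (σ - σ') * x ^ 2 + 2 * σ * (m - m') * x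
        + σ * (m - m') ^ 2 := by
      intro x
      have := mul_le_mul_of_nonneg_left (hC (m + x)) (show 0 ≤ 4 * σ * σ' by positivity)
      refine this.trans_eq ?_
      field_simp
      ring
    generalize 4 * σ * σ' * C = E at hD
    have heq : σ = σ' := by
      by_contra hne
      have hpos : 0 < σ' - σ := by
        rcases hge.lt_or_eq with h | h
        · linarith
        · exact absurd h hne
      -- Adding `hD y` and `hD (-y)` removes the linear term and leaves `E ≤ -|E| - 1`.
      set y := Real.sqrt ((σ * (m - m') ^ 2 + |E| + 1) / (σ' - σ)) with hy
      have hy2 : (σ' - σ) * y ^ 2 = σ * (m - m') ^ 2 + |E| + 1 := by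
        rw [hy, Real.sq_sqrt (by positivity)]
        field_simp
      have h1 := hD y
      have h2 := hD (-y)
      have := neg_abs_le E
      nlinarith
    refine Or.inr ⟨heq, ?_⟩
    by_contra hne
    have hne' : m - m' ≠ 0 := sub_ne_zero.2 hne
    have h1 := hD ((E - σ * (m - m') ^ 2 - 1) / (2 * σ * (m - m')))
    rw [heq, sub_self, zero_mul, zero_add, mul_div_cancel₀] at h1
    · linarith
    · have : σ' ≠ 0 := hσ'.ne'
      positivity

/-- If a multiple of one Gaussian distribution is dominated by another one, their parameters
satisfy the inequalities defining the class `Θ`. -/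
lemma gaussianReal_domination {σ σ' m m' κ : ℝ} (hσ : 0 ≤ σ) (hσ' : 0 ≤ σ') (hκ : 0 < κ)
    (h : ENNReal.ofReal κ • gaussianReal m' (2 * σ').toNNReal ≤ gaussianReal m (2 * σ).toNNReal) :
    (0 < σ' ∧ σ' < σ ∧ κ ≤ Real.sqrt (σ' / σ) * Real.exp (-((m - m') ^ 2 / (4 * (σ - σ'))))) ∨
      (σ = σ' ∧ m = m') := by
  have hκ0 : ENNReal.ofReal κ ≠ 0 := by simpa using hκ
  rcases hσ.eq_or_lt with rfl | hσ
  · right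
    rw [mul_zero, Real.toNNReal_zero, gaussianReal_zero_var] at h
    have h0 : gaussianReal m' (2 * σ').toNNReal {m}ᶜ = 0 := by
      have := h {m}ᶜ
      simpa [hκ.not_ge] using this
    rcases hσ'.eq_or_lt with rfl | hσ'
    · refine ⟨rfl, ?_⟩
      simpa [Set.indicator_apply, eq_comm] using h0
    · exfalso
      have hv : (2 * σ').toNNReal ≠ 0 := by simpa using hσ'
      have := nullSingletonClass_gaussianReal (μ := m') hv
      rw [prob_compl_eq_zero_iff (measurableSet_singleton m)] at h0
      simp at h0
  · have hv : (2 * σ).toNNReal ≠ 0 := by simpa using hσ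
    rcases hσ'.eq_or_lt with rfl | hσ'
    · exfalso
      have := nullSingletonClass_gaussianReal (μ := m) hv
      have := h {m'}
      simp [hκ.not_ge] at this
    · have hv' : (2 * σ').toNNReal ≠ 0 := by simpa using hσ'
      rw [gaussianReal_of_var_ne_zero _ hv, gaussianReal_of_var_ne_zero _ hv',
        ← withDensity_smul _ (measurable_gaussianPDF _ _)] at h
      have hae : ∀ᵐ t, (ENNReal.ofReal κ • gaussianPDF m' (2 * σ').toNNReal) t
          ≤ gaussianPDF m (2 * σ).toNNReal t := by
        refine ae_le_of_forall_setLIntegral_le_of_sigmaFinite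
          ((measurable_gaussianPDF _ _).const_smul _) fun s hs _ => ?_
        have := h s
        rwa [withDensity_apply _ hs, withDensity_apply _ hs] at this
      -- The densities are continuous, so the set where the inequality fails is open and null, hence
      -- empty.
      have hreal : ∀ t, κ * gaussianPDFReal m' (2 * σ').toNNReal t
          ≤ gaussianPDFReal m (2 * σ).toNNReal t := by
        have hopen : IsOpen {t | gaussianPDFReal m (2 * σ).toNNReal t
            < κ * gaussianPDFReal m' (2 * σ').toNNReal t} := by
          simp only [gaussianPDFReal_def]
          exact isOpen_lt (by fun_prop) (by fun_prop)
        have hnull : volume {t | gaussianPDFReal m (2 * σ).toNNReal t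
            < κ * gaussianPDFReal m' (2 * σ').toNNReal t} = 0 := by
          refine measure_mono_null ?_ (ae_iff.1 hae)
          intro t ht hle
          simp only [Pi.smul_apply, smul_eq_mul, gaussianPDF,
            ← ENNReal.ofReal_mul hκ.le] at hle
          rw [ENNReal.ofReal_le_ofReal_iff (gaussianPDFReal_nonneg _ _ _)] at hle
          exact absurd ht (not_lt.2 hle)
        intro t
        by_contra hlt
        have := (hopen.measure_eq_zero_iff volume).1 hnull
        exact Set.notMem_empty t (this ▸ not_le.1 hlt)
      have hpt : ∀ t, κ ≤ Real.sqrt (σ' / σ) *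
          Real.exp ((t - m') ^ 2 / (4 * σ') - (t - m) ^ 2 / (4 * σ)) := by
        intro t
        have := hreal t
        simp only [gaussianPDFReal, Real.coe_toNNReal _ (show 0 ≤ 2 * σ by positivity),
          Real.coe_toNNReal _ (show 0 ≤ 2 * σ' by positivity)] at this
        have e1 : -(t - m') ^ 2 / (2 * (2 * σ')) = -((t - m') ^ 2 / (4 * σ')) := by
          rw [neg_div]; congr 2; ring
        have e2 : -(t - m) ^ 2 / (2 * (2 * σ)) = -((t - m) ^ 2 / (4 * σ)) := by
          rw [neg_div]; congr 2; ring
        rw [e1, e2, Real.exp_neg, Real.exp_neg] at this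
        have e3 : Real.sqrt (σ' / σ) = Real.sqrt (2 * Real.pi * (2 * σ')) *
            (Real.sqrt (2 * Real.pi * (2 * σ)))⁻¹ := by
          rw [← Real.sqrt_inv, ← Real.sqrt_mul (by positivity)]
          congr 1
          field_simp
        rw [e3, Real.exp_sub]
        have p1 : 0 < Real.sqrt (2 * Real.pi * (2 * σ')) := by positivity
        have p2 := Real.exp_pos ((t - m') ^ 2 / (4 * σ'))
        calc κ = (κ * ((Real.sqrt (2 * Real.pi * (2 * σ')))⁻¹ *
              (Real.exp ((t - m') ^ 2 / (4 * σ')))⁻¹)) *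
              (Real.sqrt (2 * Real.pi * (2 * σ')) * Real.exp ((t - m') ^ 2 / (4 * σ'))) := by
              field_simp
          _ ≤ _ := mul_le_mul_of_nonneg_right this (by positivity)
          _ = _ := by ring
      rcases gaussian_exponent_domination hσ hσ' hκ hpt with h1 | h1
      · exact Or.inl ⟨hσ', h1⟩
      · exact Or.inr h1

/-- The slice at `n` of a measure on `ℝ × ℤ(2)`. -/
noncomputable def slice (γ : Measure (ℝ × ZMod 2)) (n : ZMod 2) : Measure ℝ :=
  (γ.restrict (Prod.snd ⁻¹' {n})).map Prod.fst

instance (γ : Measure (ℝ × ZMod 2)) [IsFiniteMeasure γ] (n : ZMod 2) :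
    IsFiniteMeasure (slice γ n) := by
  unfold slice; infer_instance

lemma charRZ2_apply (s : ℝ) (n : ZMod 2) (x : ℝ × ZMod 2) :
    ((charRZ2 s n x : Circle) : ℂ) =
      Complex.exp (s * x.1 * Complex.I) * (ZMod.toCircle (x.2 * n) : Circle) := by
  simp [charRZ2, Circle.coe_exp, mul_comm]

lemma measurable_charRZ2 (s : ℝ) (n : ZMod 2) :
    Measurable fun x => ((charRZ2 s n x : Circle) : ℂ) := by
  simp only [charRZ2_apply]
  have : Measurable fun m : ZMod 2 => ((ZMod.toCircle (m * n) : Circle) : ℂ) :=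
    measurable_of_countable _
  fun_prop

lemma integrable_charRZ2 (γ : Measure (ℝ × ZMod 2)) [IsFiniteMeasure γ] (s : ℝ) (n : ZMod 2) :
    Integrable (fun x => ((charRZ2 s n x : Circle) : ℂ)) γ :=
  Integrable.of_bound (measurable_charRZ2 s n).aestronglyMeasurable 1
    (Filter.Eventually.of_forall fun _ => (Circle.norm_coe _).le)

lemma charFun_slice (γ : Measure (ℝ × ZMod 2)) (n : ZMod 2) (s : ℝ) :
    charFun (slice γ n) s =
      ∫ x in Prod.snd ⁻¹' {n}, Complex.exp (s * x.1 * Complex.I) ∂γ := by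
  rw [charFun_apply_real, slice, integral_map (by fun_prop) (by fun_prop)]

/-- Characters with `n = 0` see the sum of the two slices and those with `n = 1` see their
difference. Positivity of the slices enters the description of `Θ` through this. -/
lemma charFn_charRZ2_eq (γ : Measure (ℝ × ZMod 2)) [IsFiniteMeasure γ] (s : ℝ) (n : ZMod 2) :
    charFn γ (charRZ2 s n) = charFun (slice γ 0) s +
      (ZMod.toCircle n : Circle) * charFun (slice γ 1) s := by
  have hm : ∀ k : ZMod 2, MeasurableSet ((Prod.snd : ℝ × ZMod 2 → ZMod 2) ⁻¹' {k}) := fun k =>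
    measurable_snd (measurableSet_singleton k)
  have hc : (Prod.snd : ℝ × ZMod 2 → ZMod 2) ⁻¹' {1} = (Prod.snd ⁻¹' {0})ᶜ := by
    ext x
    have : ∀ k : ZMod 2, k = 1 ↔ ¬ k = 0 := by decide
    simp [this]
  rw [charFn, ← integral_add_compl (hm 0) (integrable_charRZ2 γ s n), ← hc, charFun_slice,
    charFun_slice, ← integral_const_mul]
  congr 1
  · refine setIntegral_congr_fun (hm 0) fun x hx => ?_
    have hx : x.2 = 0 := hx
    simp [charRZ2_apply, hx]
  · refine setIntegral_congr_fun (hm 1) fun x hx => ?_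
    have hx : x.2 = 1 := hx
    simp [charRZ2_apply, hx, mul_comm]

lemma charFun_ofReal_smul (c : ℝ) (hc : 0 ≤ c) (ν : Measure ℝ) (s : ℝ) :
    charFun (ENNReal.ofReal c • ν) s = c * charFun ν s := by
  rw [charFun_apply, integral_smul_measure, ENNReal.toReal_ofReal hc, charFun_apply]
  simp

lemma charFun_add_measure (μ ν : Measure ℝ) [IsFiniteMeasure μ] [IsFiniteMeasure ν] (s : ℝ) :
    charFun (μ + ν) s = charFun μ s + charFun ν s := by
  have h : ∀ (ρ : Measure ℝ) [IsFiniteMeasure ρ],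
      Integrable (fun x : ℝ => Complex.exp (s * x * Complex.I)) ρ := fun ρ _ =>
    Integrable.of_bound (by fun_prop) 1 (by
      refine Filter.Eventually.of_forall fun x => ?_
      rw [← Complex.ofReal_mul, Complex.norm_exp_ofReal_mul_I])
  simp only [charFun_apply_real]
  exact integral_add_measure (h μ) (h ν)

/-- A probability distribution on `ℝ × ℤ(2)` whose characteristic function is of Gaussian type on
both components belongs to the class `Θ`. -/
lemma classTheta_of_charFn {γ : Measure (ℝ × ZMod 2)} [IsProbabilityMeasure γ]
    {σ σ' m m' κ : ℝ} (hσ : 0 ≤ σ) (hσ' : 0 ≤ σ') (hκ : κ ≠ 0)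
    (h0 : ∀ s : ℝ, charFn γ (charRZ2 s 0) = Complex.exp (-σ * s ^ 2 + Complex.I * m * s))
    (h1 : ∀ s : ℝ, charFn γ (charRZ2 s 1) = κ * Complex.exp (-σ' * s ^ 2 + Complex.I * m' * s)) :
    ClassTheta γ := by
  have hN : ∀ (σ m : ℝ), 0 ≤ σ → ∀ s : ℝ, charFun (gaussianReal m (2 * σ).toNNReal) s =
      Complex.exp (-σ * s ^ 2 + Complex.I * m * s) := by
    intro σ m hσ s
    rw [charFun_gaussianReal, Real.coe_toNNReal _ (by positivity)]
    congr 1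
    push_cast
    ring
  have hsum : slice γ 0 + slice γ 1 = gaussianReal m (2 * σ).toNNReal := by
    refine Measure.ext_of_charFun (funext fun s => ?_)
    rw [charFun_add_measure, hN σ m hσ, ← h0, charFn_charRZ2_eq]
    simp
  have hdiff : ∀ s, charFun (slice γ 0) s - charFun (slice γ 1) s =
      κ * charFun (gaussianReal m' (2 * σ').toNNReal) s := by
    intro s
    rw [hN σ' m' hσ', ← h1, charFn_charRZ2_eq, toCircle_two_one]
    ring
  -- One slice exceeds the other by `|κ|` times the second Gaussian, the sign of `κ` deciding which.
  -- Since the smaller slice is nonnegative, the sum dominates that difference.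
  have hdom : ENNReal.ofReal |κ| • gaussianReal m' (2 * σ').toNNReal
      ≤ gaussianReal m (2 * σ).toNNReal := by
    have : IsFiniteMeasure (ENNReal.ofReal |κ| • gaussianReal m' (2 * σ').toNNReal) :=
      Measure.smul_finite _ ENNReal.ofReal_ne_top
    rcases lt_or_gt_of_ne hκ with hneg | hpos
    · have : slice γ 1 = slice γ 0 + ENNReal.ofReal |κ| • gaussianReal m' (2 * σ').toNNReal := by
        refine Measure.ext_of_charFun (funext fun s => ?_)
        have := hdiff s
        rw [charFun_add_measure, charFun_ofReal_smul _ (abs_nonneg κ), abs_of_neg hneg]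
        push_cast
        linear_combination -this
      rw [← hsum, this]
      exact (Measure.le_add_left le_rfl).trans (Measure.le_add_left le_rfl)
    · have : slice γ 0 = slice γ 1 + ENNReal.ofReal |κ| • gaussianReal m' (2 * σ').toNNReal := by
        refine Measure.ext_of_charFun (funext fun s => ?_)
        have := hdiff s
        rw [charFun_add_measure, charFun_ofReal_smul _ (abs_nonneg κ), abs_of_pos hpos]
        linear_combination this
      rw [← hsum, this]
      exact (Measure.le_add_left le_rfl).trans (Measure.le_add_right le_rfl)
  have hκ1 : |κ| ≤ 1 := by
    have := h1 0
    simp only [Complex.ofReal_zero, ne_eq, OfNat.ofNat_ne_zero, not_false_eq_true, zero_pow,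
      mul_zero, add_zero, Complex.exp_zero, mul_one] at this
    rw [← Real.norm_eq_abs, ← Complex.norm_real, ← this]
    refine (norm_integral_le_of_norm_le_const (C := 1)
      (Filter.Eventually.of_forall fun _ => (Circle.norm_coe _).le)).trans ?_
    simp
  refine ⟨inferInstance, σ, σ', m, m', κ, hσ, hσ', h0, h1, ?_⟩
  rcases gaussianReal_domination hσ hσ' (abs_pos.2 hκ) hdom with ⟨a, b, c⟩ | ⟨a, b⟩
  · exact Or.inl ⟨a, b, abs_pos.2 hκ, c⟩
  · exact Or.inr ⟨a, b, hκ1⟩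

/-! ### Fibres over `G` and uniqueness of characteristic functions -/

/-- A measure is determined by its pieces on the fibres of a map to a countable space. -/
lemma ext_of_fibres {X Y F : Type*} [MeasurableSpace X] [MeasurableSpace Y] [MeasurableSpace F]
    [Countable F] [MeasurableSingletonClass F] {μ ν : Measure X} {f : X → F} {p : X → Y}
    {e : F → Y → X} (hf : Measurable f) (hp : Measurable p) (he : ∀ k, Measurable (e k))
    (hep : ∀ x, e (f x) (p x) = x)
    (h : ∀ k, (μ.restrict (f ⁻¹' {k})).map p = (ν.restrict (f ⁻¹' {k})).map p) : μ = ν := by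
  have key : ∀ (ρ : Measure X) k,
      ρ.restrict (f ⁻¹' {k}) = ((ρ.restrict (f ⁻¹' {k})).map p).map (e k) := by
    intro ρ k
    rw [Measure.map_map (he k) hp]
    conv_lhs => rw [← Measure.map_id (μ := ρ.restrict (f ⁻¹' {k}))]
    refine Measure.map_congr ?_
    filter_upwards [ae_restrict_mem (hf (measurableSet_singleton k))] with x hx
    have hx : f x = k := hx
    simp [← hx, hep]
  refine (Measure.ext_iff_of_iUnion_eq_univ (s := fun k => f ⁻¹' {k}) ?_).2 fun k => ?_
  · ext x; simp
  · rw [key μ, key ν, h]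

/-- Finite measures on `ℝ × ℤ(2)` are determined by their characteristic functions. -/
lemma ext_of_charFn_charRZ2 {μ ν : Measure (ℝ × ZMod 2)} [IsFiniteMeasure μ] [IsFiniteMeasure ν]
    (h : ∀ s n, charFn μ (charRZ2 s n) = charFn ν (charRZ2 s n)) : μ = ν := by
  have h0 : ∀ s, charFun (slice μ 0) s = charFun (slice ν 0) s ∧
      charFun (slice μ 1) s = charFun (slice ν 1) s := by
    intro s
    have e0 := h s 0
    have e1 := h s 1
    simp only [charFn_charRZ2_eq, toCircle_two_one, AddChar.map_zero_eq_one, Circle.coe_one]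
      at e0 e1
    exact ⟨by linear_combination (e0 + e1) / 2, by linear_combination (e0 - e1) / 2⟩
  refine ext_of_fibres (f := Prod.snd) (p := Prod.fst) (e := fun k t => (t, k)) measurable_snd
    measurable_fst (fun k => by fun_prop) (fun _ => rfl) fun k => ?_
  have : ∀ k : ZMod 2, k = 0 ∨ k = 1 := by decide
  rcases this k with rfl | rfl
  · exact Measure.ext_of_charFun (μ := slice μ 0) (ν := slice ν 0) (funext fun s => (h0 s).1)
  · exact Measure.ext_of_charFun (μ := slice μ 1) (ν := slice ν 1) (funext fun s => (h0 s).2)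

/-- The part of a measure on `ℝ × ℤ(2) × G` lying over `k ∈ G`. -/
noncomputable def fibre {G : Type*} [MeasurableSpace G] (μ : Measure (ℝ × ZMod 2 × G)) (k : G) : Measure (ℝ × ZMod 2) :=
  (μ.restrict ((fun x => x.2.2) ⁻¹' {k})).map fun x => (x.1, x.2.1)

instance {G : Type*} [MeasurableSpace G] (μ : Measure (ℝ × ZMod 2 × G)) [IsFiniteMeasure μ] (k : G) :
    IsFiniteMeasure (fibre μ k) := by
  unfold fibre; infer_instance

lemma charFn_fibre {G : Type*} [MeasurableSpace G] (μ : Measure (ℝ × ZMod 2 × G)) (k : G) (s : ℝ) (n : ZMod 2) :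
    charFn (fibre μ k) (charRZ2 s n) =
      ∫ x in (fun x => x.2.2) ⁻¹' {k}, ((charRZ2 s n (x.1, x.2.1) : Circle) : ℂ) ∂μ := by
  have := measurable_charRZ2 s n
  rw [charFn, fibre, integral_map (by fun_prop) (by fun_prop)]

lemma finite_addChar_circle {G : Type*} [AddCommGroup G] [Finite G] :
    Finite (AddChar G Circle) :=
  Finite.of_equiv _ AddChar.circleEquivComplex.symm.toEquiv

section

variable {G : Type*} [AddCommGroup G]

/-- The character of `ℝ × ℤ(2) × G` with coordinates `(s, n, ψ)`. -/
noncomputable def charX (s : ℝ) (n : ZMod 2) (ψ : AddChar G Circle) :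
    AddChar (ℝ × ZMod 2 × G) Circle where
  toFun x := charRZ2 s n (x.1, x.2.1) * ψ x.2.2
  map_zero_eq_one' := by
    rw [Prod.fst_zero, Prod.snd_zero, Prod.fst_zero, Prod.snd_zero, ← Prod.zero_eq_mk,
      AddChar.map_zero_eq_one, AddChar.map_zero_eq_one, one_mul]
  map_add_eq_mul' x y := by
    rw [Prod.fst_add, Prod.snd_add, Prod.fst_add, Prod.snd_add, ← Prod.mk_add_mk,
      AddChar.map_add_eq_mul, AddChar.map_add_eq_mul, mul_mul_mul_comm]

lemma charX_apply (s : ℝ) (n : ZMod 2) (ψ : AddChar G Circle) (x : ℝ × ZMod 2 × G) :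
    charX s n ψ x = charRZ2 s n (x.1, x.2.1) * ψ x.2.2 := rfl

lemma charRZ2_add (s s' : ℝ) (n n' : ZMod 2) (x : ℝ × ZMod 2) :
    charRZ2 (s + s') (n + n') x = charRZ2 s n x * charRZ2 s' n' x := by
  simp only [charRZ2, AddChar.coe_mk, mul_add, Circle.exp_add, AddChar.map_add_eq_mul]
  exact mul_mul_mul_comm _ _ _ _

lemma charX_add (s s' : ℝ) (n n' : ZMod 2) (ψ ψ' : AddChar G Circle) (x : ℝ × ZMod 2 × G) :
    charX (s + s') (n + n') (ψ + ψ') x = charX s n ψ x * charX s' n' ψ' x := by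
  simp only [charX_apply, charRZ2_add, AddChar.add_apply]
  exact mul_mul_mul_comm _ _ _ _

lemma continuous_charX [Finite G] [TopologicalSpace G] [DiscreteTopology G]
    (s : ℝ) (n : ZMod 2) (ψ : AddChar G Circle) : Continuous (charX s n ψ) := by
  have h1 : Continuous fun m : ZMod 2 => ZMod.toCircle (m * n) := continuous_of_discreteTopology
  have h2 : Continuous ψ := continuous_of_discreteTopology
  have h3 : (charX s n ψ : ℝ × ZMod 2 × G → Circle) = fun x =>
      Circle.exp (x.1 * s) * ZMod.toCircle (x.2.1 * n) * ψ x.2.2 := rfl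
  rw [h3]
  fun_prop

variable [Finite G] [MeasurableSpace G] [MeasurableSingletonClass G]

lemma measurable_charX (s : ℝ) (n : ZMod 2) (ψ : AddChar G Circle) :
    Measurable fun x => ((charX s n ψ x : Circle) : ℂ) := by
  have h1 : Measurable fun g : G => ((ψ g : Circle) : ℂ) := measurable_of_countable _
  have h2 := measurable_charRZ2 s n
  simp only [charX_apply, Circle.coe_mul]
  fun_prop

lemma integrable_charX (μ : Measure (ℝ × ZMod 2 × G)) [IsFiniteMeasure μ]
    (s : ℝ) (n : ZMod 2) (ψ : AddChar G Circle) :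
    Integrable (fun x => ((charX s n ψ x : Circle) : ℂ)) μ :=
  Integrable.of_bound (measurable_charX s n ψ).aestronglyMeasurable 1
    (Filter.Eventually.of_forall fun _ => (Circle.norm_coe _).le)

/-- The characteristic function of a measure in terms of those of its fibres over `G`. -/
lemma charFn_charX_eq_sum [Fintype G] (μ : Measure (ℝ × ZMod 2 × G)) [IsFiniteMeasure μ]
    (s : ℝ) (n : ZMod 2) (ψ : AddChar G Circle) :
    charFn μ (charX s n ψ) = ∑ k, (ψ k : ℂ) * charFn (fibre μ k) (charRZ2 s n) := by
  have hm : ∀ k : G, MeasurableSet ((fun x : ℝ × ZMod 2 × G => x.2.2) ⁻¹' {k}) := fun k =>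
    (by fun_prop : Measurable fun x : ℝ × ZMod 2 × G => x.2.2) (measurableSet_singleton k)
  rw [charFn, ← setIntegral_univ, ← Set.iUnion_eq_univ_iff.2
    (fun x : ℝ × ZMod 2 × G => ⟨x.2.2, rfl⟩ :
      ∀ x, ∃ k, x ∈ (fun x : ℝ × ZMod 2 × G => x.2.2) ⁻¹' {k}),
    integral_iUnion_fintype hm (fun i j hij => Set.disjoint_left.2 fun x hi hj =>
      hij ((show x.2.2 = i from hi).symm.trans hj)) fun k =>
      (integrable_charX μ s n ψ).integrableOn]
  refine Finset.sum_congr rfl fun k _ => ?_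
  rw [charFn_fibre, ← integral_const_mul]
  refine setIntegral_congr_fun (hm k) fun x hx => ?_
  have hx : x.2.2 = k := hx
  simp [charX_apply, hx, mul_comm]

/-- Fourier inversion over `G`. -/
lemma charFn_fibre_eq_sum [Fintype G] [Fintype (AddChar G Circle)]
    (μ : Measure (ℝ × ZMod 2 × G)) [IsFiniteMeasure μ] (s : ℝ) (n : ZMod 2) (k : G) :
    charFn (fibre μ k) (charRZ2 s n) =
      (Fintype.card G : ℂ)⁻¹ * ∑ ψ : AddChar G Circle, (ψ (-k) : ℂ) * charFn μ (charX s n ψ) := by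
  classical
  have horth : ∀ g : G, ∑ ψ : AddChar G Circle, (ψ g : ℂ) =
      if g = 0 then (Fintype.card G : ℂ) else 0 := by
    intro g
    rw [← AddChar.sum_apply_eq_ite (α := G) g]
    exact Fintype.sum_equiv AddChar.circleEquivComplex.toEquiv _ _ fun _ => rfl
  simp only [charFn_charX_eq_sum, Finset.mul_sum]
  rw [Finset.sum_comm]
  have : ∀ j : G, ∑ ψ : AddChar G Circle, (Fintype.card G : ℂ)⁻¹ *
      ((ψ (-k) : ℂ) * ((ψ j : ℂ) * charFn (fibre μ j) (charRZ2 s n))) =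
      if j = k then charFn (fibre μ k) (charRZ2 s n) else 0 := by
    intro j
    have e : ∀ ψ : AddChar G Circle, (Fintype.card G : ℂ)⁻¹ *
      ((ψ (-k) : ℂ) * ((ψ j : ℂ) * charFn (fibre μ j) (charRZ2 s n))) = (ψ (j - k) : ℂ) *
        ((Fintype.card G : ℂ)⁻¹ * charFn (fibre μ j) (charRZ2 s n)) := by
      intro ψ
      rw [sub_eq_add_neg, AddChar.map_add_eq_mul, Circle.coe_mul]
      ring
    simp only [e]
    rw [← Finset.sum_mul, horth]
    by_cases hj : j = k
    · simp [hj]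
    · simp [hj, sub_eq_zero]
  simp only [this, Finset.sum_ite_eq', Finset.mem_univ, if_true]

/-- Finite measures on `ℝ × ℤ(2) × G` are determined by their characteristic functions. -/
lemma ext_of_charFn_charX {μ ν : Measure (ℝ × ZMod 2 × G)} [IsFiniteMeasure μ] [IsFiniteMeasure ν]
    (h : ∀ s n ψ, charFn μ (charX s n ψ) = charFn ν (charX s n ψ)) : μ = ν := by
  have := Fintype.ofFinite G
  have := finite_addChar_circle (G := G)
  have := Fintype.ofFinite (AddChar G Circle)
  refine ext_of_fibres (f := fun x : ℝ × ZMod 2 × G => x.2.2) (p := fun x => (x.1, x.2.1))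
    (e := fun k y => (y.1, y.2, k)) (by fun_prop) (by fun_prop) (fun k => by fun_prop)
    (fun _ => rfl) fun k => ?_
  refine ext_of_charFn_charRZ2 (μ := fibre μ k) (ν := fibre ν k) fun s n => ?_
  simp only [charFn_fibre_eq_sum, h]

end

/-! ### From conditional symmetry to the functional equation -/

lemma charFn_conv {X : Type*} [AddCommGroup X] [MeasurableSpace X] [MeasurableAdd₂ X]
    (μ ν : Measure X) [IsFiniteMeasure μ] [IsFiniteMeasure ν] {χ : AddChar X Circle}
    (hχ : Measurable fun x => ((χ x : Circle) : ℂ)) :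
    charFn (μ ∗ ν) χ = charFn μ χ * charFn ν χ := by
  have hint : Integrable (fun x => ((χ x : Circle) : ℂ)) (μ ∗ ν) :=
    Integrable.of_bound hχ.aestronglyMeasurable 1
      (Filter.Eventually.of_forall fun _ => (Circle.norm_coe _).le)
  simp only [charFn]
  rw [integral_conv hint]
  simp only [AddChar.map_add_eq_mul, Circle.coe_mul, integral_const_mul, integral_mul_const]

/-- Symmetry of the conditional distribution of `L₂` given `L₁` means that `(L₁, L₂)` and
`(L₁, -L₂)` are identically distributed. -/
lemma map_prod_eq_of_condDistribSymmetric {Ω X : Type*} [MeasurableSpace Ω] [AddCommGroup X]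
    [MeasurableSpace X] [StandardBorelSpace X] [MeasurableNeg X] {P : Measure Ω}
    [IsFiniteMeasure P] {L₁ L₂ : Ω → X} (h₁ : Measurable L₁) (h₂ : Measurable L₂)
    (h : CondDistribSymmetric L₂ L₁ P) :
    P.map (fun w => (L₁ w, L₂ w)) = P.map fun w => (L₁ w, -L₂ w) := by
  have e : (P.map fun w => (L₁ w, -L₂ w)) =
      (P.map fun w => (L₁ w, L₂ w)).map (fun x : X × X => (x.1, -x.2)) := by
    rw [Measure.map_map (by fun_prop) (by fun_prop)]
    rfl
  rw [e, ← compProd_map_condDistrib h₂.aemeasurable]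
  ext s hs
  have hm : Measurable fun x : X × X => (x.1, -x.2) := by fun_prop
  rw [Measure.map_apply hm hs, Measure.compProd_apply hs, Measure.compProd_apply (hm hs)]
  refine lintegral_congr_ae ?_
  filter_upwards [h] with x hx
  conv_lhs => rw [← hx, Measure.map_apply measurable_neg (measurable_prodMk_left hs)]
  rfl

section

variable {G : Type*} [AddCommGroup G]

/-- The automorphism of the character group adjoint to an automorphism of the group. -/
noncomputable def adjointEquiv (β : G ≃+ G) : AddChar G Circle ≃+ AddChar G Circle where
  toFun ψ := ψ.compAddMonoidHom β.toAddMonoidHom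
  invFun ψ := ψ.compAddMonoidHom β.symm.toAddMonoidHom
  left_inv ψ := by ext; simp
  right_inv ψ := by ext; simp
  map_add' ψ ψ' := rfl

lemma adjointEquiv_apply (β : G ≃+ G) (ψ : AddChar G Circle) (g : G) :
    adjointEquiv β ψ g = ψ (β g) := rfl

/-- The Heyde functional equation for the characteristic functions of two measures. -/
def HeydeEq [MeasurableSpace G] (a : ℝ) (β : G ≃+ G) (μ₁ μ₂ : Measure (ℝ × ZMod 2 × G)) : Prop :=
  ∀ (s t : ℝ) (n : ZMod 2) (ψ φ : AddChar G Circle),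
    charFn μ₁ (charX (s + t) n (ψ + φ)) * charFn μ₂ (charX (s + a * t) n (ψ + adjointEquiv β φ)) =
      charFn μ₁ (charX (s - t) n (ψ - φ)) * charFn μ₂ (charX (s - a * t) n (ψ - adjointEquiv β φ))

lemma charRZ2_neg_apply (s : ℝ) (x : ℝ × ZMod 2) : charRZ2 s 0 (-x) = charRZ2 (-s) 0 x := by
  simp [charRZ2]

lemma charX_neg_apply (s : ℝ) (ψ : AddChar G Circle) (x : ℝ × ZMod 2 × G) :
    charX s 0 ψ (-x) = charX (-s) 0 (-ψ) x := by
  rw [charX_apply, charX_apply, AddChar.neg_apply, ← charRZ2_neg_apply]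
  rfl

lemma charX_automorphism_apply (a s : ℝ) (β : G ≃+ G) (ψ : AddChar G Circle)
    (x : ℝ × ZMod 2 × G) :
    charX s 0 ψ (a * x.1, x.2.1, β x.2.2) = charX (a * s) 0 (adjointEquiv β ψ) x := by
  simp only [charX_apply, adjointEquiv_apply, charRZ2, AddChar.coe_mk]
  congr 3
  ring

variable [Finite G] [TopologicalSpace G] [DiscreteTopology G] [MeasurableSpace G] [BorelSpace G]

/-- Independence and symmetry of the conditional distribution yield the Heyde functional
equation. -/
lemma heydeEq_of_map_prod_eq {Ω : Type*} [MeasurableSpace Ω] {P : Measure Ω}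
    [IsProbabilityMeasure P] {a : ℝ} {β : G ≃+ G} {ξ₁ ξ₂ : Ω → ℝ × ZMod 2 × G}
    (hξ₁ : Measurable ξ₁) (hξ₂ : Measurable ξ₂) (hindep : IndepFun ξ₁ ξ₂ P)
    {α : ℝ × ZMod 2 × G → ℝ × ZMod 2 × G} (hα : ∀ x, α x = (a * x.1, x.2.1, β x.2.2))
    (hαm : Measurable α)
    (h : P.map (fun w => (ξ₁ w + ξ₂ w, ξ₁ w + α (ξ₂ w))) =
      P.map fun w => (ξ₁ w + ξ₂ w, -(ξ₁ w + α (ξ₂ w)))) :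
    HeydeEq a β (P.map ξ₁) (P.map ξ₂) := by
  intro s t n ψ φ
  have hprod : ∀ (s₁ s₂ : ℝ) (ψ₁ ψ₂ : AddChar G Circle),
      charFn (P.map ξ₁) (charX s₁ n ψ₁) * charFn (P.map ξ₂) (charX s₂ n ψ₂) =
        ∫ w, (charX s₁ n ψ₁ (ξ₁ w) : ℂ) * (charX s₂ n ψ₂ (ξ₂ w) : ℂ) ∂P := by
    intro s₁ s₂ ψ₁ ψ₂
    have h1 := measurable_charX s₁ n ψ₁
    have h2 := measurable_charX s₂ n ψ₂
    rw [charFn, charFn, integral_map (by fun_prop) (by fun_prop),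
      integral_map (by fun_prop) (by fun_prop)]
    exact ((hindep.comp h1 h2).integral_fun_mul_eq_mul_integral
      (h1.comp hξ₁).aestronglyMeasurable (h2.comp hξ₂).aestronglyMeasurable).symm
  -- The character applied to `L₂` is taken trivial on `ℤ(2)`: `α` acts there as the identity and
  -- `-1 = 1`, so a nontrivial one would only change `n`.
  have hF : Measurable fun x : (ℝ × ZMod 2 × G) × (ℝ × ZMod 2 × G) =>
      (charX s n ψ x.1 : ℂ) * (charX t 0 φ x.2 : ℂ) := by
    have h1 := measurable_charX s n ψ
    have h2 := measurable_charX t 0 φ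
    fun_prop
  have key := congrArg (fun ρ => ∫ x, (charX s n ψ x.1 : ℂ) * (charX t 0 φ x.2 : ℂ) ∂ρ) h
  rw [integral_map (by fun_prop) hF.aestronglyMeasurable,
    integral_map (by fun_prop) hF.aestronglyMeasurable] at key
  rw [hprod, hprod]
  convert key using 3 with w w
  · rw [← Circle.coe_mul, ← Circle.coe_mul]
    congr 1
    rw [AddChar.map_add_eq_mul, AddChar.map_add_eq_mul, hα, charX_automorphism_apply]
    nth_rw 1 2 [← add_zero n]
    rw [charX_add, charX_add]
    exact mul_mul_mul_comm _ _ _ _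
  · rw [← Circle.coe_mul, ← Circle.coe_mul]
    congr 1
    rw [charX_neg_apply, AddChar.map_add_eq_mul, AddChar.map_add_eq_mul, hα,
      charX_automorphism_apply, sub_eq_add_neg, sub_eq_add_neg, sub_eq_add_neg, sub_eq_add_neg,
      mul_neg, map_neg]
    nth_rw 1 2 [← add_zero n]
    rw [charX_add, charX_add]
    exact mul_mul_mul_comm _ _ _ _

end

/-! ### Concentration on the kernel of `I + α_G` after translation -/

section

variable {G : Type*} [AddCommGroup G]

lemma eq_zero_of_two_nsmul_eq_zero (hG : ∀ g : G, addOrderOf g ≠ 2) {g : G} (h : 2 • g = 0) :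
    g = 0 := by
  by_contra hne
  exact hG g (addOrderOf_eq_prime h hne)

/-- Without elements of order two, doubling is an automorphism of the finite group `G`; composing a
character with its inverse halves the character. -/
lemma surjective_two_nsmul_addChar [Finite G] (hG : ∀ g : G, addOrderOf g ≠ 2) :
    Function.Surjective fun ψ : AddChar G Circle => 2 • ψ := by
  have hinj : Function.Injective (nsmulAddMonoidHom 2 : G →+ G) :=
    (injective_iff_map_eq_zero _).2 fun g hg => eq_zero_of_two_nsmul_eq_zero hG hg
  let e : G ≃+ G := AddEquiv.ofBijective _ (Finite.injective_iff_bijective.1 hinj)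
  intro ψ
  refine ⟨adjointEquiv e.symm ψ, ?_⟩
  ext g
  have h : e.symm g + e.symm g = g := by
    have := e.apply_symm_apply g
    rwa [show e (e.symm g) = 2 • e.symm g from rfl, two_nsmul] at this
  simp only [two_nsmul, AddChar.add_apply, adjointEquiv_apply]
  rw [← AddChar.map_add_eq_mul, h]

lemma eq_zero_of_forall_addChar [Finite G] {g : G} (h : ∀ ψ : AddChar G Circle, ψ g = 1) :
    g = 0 := by
  rw [← AddChar.forall_apply_eq_zero]
  intro ψ
  have e : ψ g = (AddChar.circleEquivComplex.symm ψ g : ℂ) := by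
    conv_lhs => rw [← AddChar.circleEquivComplex.apply_symm_apply ψ]
    rfl
  rw [e, h, Circle.coe_one]

lemma charX_zero_zero_apply (ψ : AddChar G Circle) (x : ℝ × ZMod 2 × G) :
    charX 0 0 ψ x = ψ x.2.2 := by
  simp [charX_apply, charRZ2]

variable [MeasurableSpace G]

lemma charFn_charX_zero (μ : Measure (ℝ × ZMod 2 × G)) [IsProbabilityMeasure μ] :
    charFn μ (charX 0 0 0) = 1 := by
  simp [charFn, charX_zero_zero_apply]

lemma charFn_charX_neg (μ : Measure (ℝ × ZMod 2 × G)) (s : ℝ) (n : ZMod 2)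
    (ψ : AddChar G Circle) :
    charFn μ (charX (-s) n (-ψ)) = (starRingEnd ℂ) (charFn μ (charX s n ψ)) := by
  rw [charFn, charFn, ← integral_conj]
  refine integral_congr_ae (Filter.Eventually.of_forall fun x => ?_)
  have h2 : ∀ n m : ZMod 2, ZMod.toCircle (n * m) = (ZMod.toCircle (n * m))⁻¹ := by
    intro n m
    rw [← AddChar.map_neg_eq_inv]
    congr 1
    revert n m
    decide
  have : charX (-s) n (-ψ) x = (charX s n ψ x)⁻¹ := by
    simp only [charX_apply, charRZ2, AddChar.coe_mk, AddChar.neg_apply, mul_inv, mul_neg,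
      Circle.exp_neg, AddChar.map_neg_eq_inv]
    rw [← h2]
  simp only [this, Circle.coe_inv_eq_conj]

lemma norm_charFn_le_one {X : Type*} [AddCommGroup X] [MeasurableSpace X] (μ : Measure X)
    [IsProbabilityMeasure μ] (χ : AddChar X Circle) : ‖charFn μ χ‖ ≤ 1 := by
  refine (norm_integral_le_of_norm_le_const (C := 1)
    (Filter.Eventually.of_forall fun _ => (Circle.norm_coe _).le)).trans ?_
  simp

/-- A character whose mean value has modulus one is almost surely equal to this mean value. -/
lemma ae_eq_charFn_of_norm_eq_one {X : Type*} [AddCommGroup X] [MeasurableSpace X] (μ : Measure X)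
    [IsProbabilityMeasure μ] {χ : AddChar X Circle} (h : ‖charFn μ χ‖ = 1) :
    ∀ᵐ x ∂μ, (χ x : ℂ) = charFn μ χ := by
  rcases ae_eq_const_or_norm_integral_lt_of_norm_le_const (μ := μ) (C := 1)
    (f := fun x => ((χ x : Circle) : ℂ))
    (Filter.Eventually.of_forall fun _ => (Circle.norm_coe _).le) with h1 | h1
  · filter_upwards [h1] with x hx
    rw [hx, average_eq_integral]
    rfl
  · rw [probReal_univ, one_mul] at h1
    exact absurd h h1.ne

/-- Taking `log ‖·‖` of the Heyde equation at `s = t = 0`, `n = 0` yields exactly the setting of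
`vanish_of_heyde` on the finite dual of `G`. -/
lemma norm_charFn_add_adjoint_eq_one [Finite G] (hG : ∀ g : G, addOrderOf g ≠ 2) {a : ℝ}
    {β : G ≃+ G} {μ₁ μ₂ : Measure (ℝ × ZMod 2 × G)} [IsProbabilityMeasure μ₁]
    [IsProbabilityMeasure μ₂] (h : HeydeEq a β μ₁ μ₂)
    (h1 : ∀ s n ψ, charFn μ₁ (charX s n ψ) ≠ 0) (h2 : ∀ s n ψ, charFn μ₂ (charX s n ψ) ≠ 0)
    (ψ : AddChar G Circle) :
    ‖charFn μ₁ (charX 0 0 (ψ + adjointEquiv β ψ))‖ = 1 ∧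
      ‖charFn μ₂ (charX 0 0 (ψ + adjointEquiv β ψ))‖ = 1 := by
  have := finite_addChar_circle (G := G)
  have hodd : ∀ (μ : Measure (ℝ × ZMod 2 × G)) (ψ : AddChar G Circle),
      Real.log ‖charFn μ (charX 0 0 (-ψ))‖ = Real.log ‖charFn μ (charX 0 0 ψ)‖ := by
    intro μ ψ
    have := charFn_charX_neg μ 0 0 ψ
    rw [neg_zero] at this
    rw [this, RCLike.norm_conj]
  have key := vanish_of_heyde (surjective_two_nsmul_addChar hG) (adjointEquiv β)
    (fun ψ => Real.log ‖charFn μ₁ (charX 0 0 ψ)‖) (fun ψ => Real.log ‖charFn μ₂ (charX 0 0 ψ)‖)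
    (by
      intro u v
      have := h 0 0 0 u v
      simp only [mul_zero, add_zero, sub_zero] at this
      have e := congrArg (fun z => Real.log ‖z‖) this
      simp only [norm_mul] at e
      rwa [Real.log_mul (norm_ne_zero_iff.2 (h1 _ _ _)) (norm_ne_zero_iff.2 (h2 _ _ _)),
        Real.log_mul (norm_ne_zero_iff.2 (h1 _ _ _)) (norm_ne_zero_iff.2 (h2 _ _ _))] at e)
    (by simp [charFn_charX_zero]) (by simp [charFn_charX_zero])
    (fun ψ => Real.log_nonpos (norm_nonneg _) (norm_charFn_le_one _ _))
    (fun ψ => Real.log_nonpos (norm_nonneg _) (norm_charFn_le_one _ _))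
    (hodd μ₁) (hodd μ₂) ψ
  constructor
  · exact Real.eq_one_of_pos_of_log_eq_zero (norm_pos_iff.2 (h1 _ _ _)) key.1
  · exact Real.eq_one_of_pos_of_log_eq_zero (norm_pos_iff.2 (h2 _ _ _)) key.2

/-- Each character evaluated at `g + βg` is almost surely constant. There are finitely many
characters, so one sample point realises all these constants, and characters separate points of `G`.
-/
lemma exists_ae_sub_mem_ker [Finite G] {β : G ≃+ G} {μ : Measure (ℝ × ZMod 2 × G)}
    [IsProbabilityMeasure μ] (h : ∀ ψ, ‖charFn μ (charX 0 0 (ψ + adjointEquiv β ψ))‖ = 1) :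
    ∃ g₀ : G, (∀ᵐ x ∂μ, x.2.2 + β x.2.2 = g₀ + β g₀) ∧
      ∀ ψ : AddChar G Circle, charFn μ (charX 0 0 (ψ + adjointEquiv β ψ)) = ψ (g₀ + β g₀) := by
  have := finite_addChar_circle (G := G)
  have hae : ∀ᵐ x ∂μ, ∀ ψ : AddChar G Circle,
      (ψ (x.2.2 + β x.2.2) : ℂ) = charFn μ (charX 0 0 (ψ + adjointEquiv β ψ)) := by
    rw [ae_all_iff]
    intro ψ
    filter_upwards [ae_eq_charFn_of_norm_eq_one μ (h ψ)] with x hx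
    rw [← hx, charX_zero_zero_apply, AddChar.add_apply, adjointEquiv_apply,
      AddChar.map_add_eq_mul]
  obtain ⟨x₀, hx₀⟩ := hae.exists
  refine ⟨x₀.2.2, ?_, fun ψ => (hx₀ ψ).symm⟩
  filter_upwards [hae] with x hx
  rw [← sub_eq_zero]
  refine eq_zero_of_forall_addChar fun ψ => ?_
  rw [sub_eq_add_neg, AddChar.map_add_eq_mul, AddChar.map_neg_eq_inv, mul_inv_eq_one]
  exact Circle.coe_injective ((hx ψ).trans (hx₀ ψ).symm)

variable [Finite G] [TopologicalSpace G] [DiscreteTopology G] [BorelSpace G]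

lemma charFn_map_sub (μ : Measure (ℝ × ZMod 2 × G)) (g : G) (s : ℝ) (n : ZMod 2)
    (ψ : AddChar G Circle) :
    charFn (μ.map fun x => x - (0, 0, g)) (charX s n ψ) =
      charFn μ (charX s n ψ) * (ψ (-g) : Circle) := by
  have := measurable_charX s n ψ
  rw [charFn, integral_map (by fun_prop) (by fun_prop), charFn, ← integral_mul_const]
  refine integral_congr_ae (Filter.Eventually.of_forall fun x => ?_)
  simp only
  rw [sub_eq_add_neg, AddChar.map_add_eq_mul, Circle.coe_mul]
  congr 2
  simp [charX_apply, charRZ2]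
  rfl

/-- After suitable translations, solutions of the Heyde equation are concentrated on
`ℝ × ℤ(2) × Ker (I + β)`. -/
lemma exists_shift (hG : ∀ g : G, addOrderOf g ≠ 2) {a : ℝ}
    {β : G ≃+ G} {μ₁ μ₂ : Measure (ℝ × ZMod 2 × G)} [IsProbabilityMeasure μ₁]
    [IsProbabilityMeasure μ₂] (h : HeydeEq a β μ₁ μ₂)
    (h1 : ∀ s n ψ, charFn μ₁ (charX s n ψ) ≠ 0) (h2 : ∀ s n ψ, charFn μ₂ (charX s n ψ) ≠ 0) :
    ∃ g₁ g₂ : G,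
      HeydeEq a β (μ₁.map fun x => x - (0, 0, g₁)) (μ₂.map fun x => x - (0, 0, g₂)) ∧
      (∀ᵐ x ∂μ₁.map fun x => x - (0, 0, g₁), x.2.2 ∈ kerIdAdd β) ∧
      (∀ᵐ x ∂μ₂.map fun x => x - (0, 0, g₂), x.2.2 ∈ kerIdAdd β) := by
  have hnorm := norm_charFn_add_adjoint_eq_one hG h h1 h2
  obtain ⟨c₁, hc1, hf1⟩ := exists_ae_sub_mem_ker fun ψ => (hnorm ψ).1
  obtain ⟨c₂, hc2, hf2⟩ := exists_ae_sub_mem_ker fun ψ => (hnorm ψ).2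
  -- Every value of the Heyde equation at `u = v = θ + β̃θ` is known explicitly, `β̃` being the
  -- adjoint of `β`. The equation reduces to `θ` being trivial on twice the element in question.
  have hc : (c₁ + β c₁) + β (c₂ + β c₂) = 0 := by
    refine eq_zero_of_two_nsmul_eq_zero hG (eq_zero_of_forall_addChar fun θ => ?_)
    have := h 0 0 0 (θ + adjointEquiv β θ) (θ + adjointEquiv β θ)
    simp only [mul_zero, add_zero, sub_self] at this
    have e1 : θ + adjointEquiv β θ + (θ + adjointEquiv β θ) =
        (θ + θ) + adjointEquiv β (θ + θ) := by rw [map_add]; abel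
    have e2 : θ + adjointEquiv β θ - adjointEquiv β (θ + adjointEquiv β θ) =
        (θ - adjointEquiv β θ) + adjointEquiv β (θ - adjointEquiv β θ) := by
      rw [map_add, map_sub]; abel
    rw [e1, hf1, hf2, e2, hf2, charFn_charX_zero, one_mul, ← Circle.coe_mul] at this
    replace this : (θ + θ) (c₁ + β c₁) * (θ + adjointEquiv β θ) (c₂ + β c₂) =
        (θ - adjointEquiv β θ) (c₂ + β c₂) := Circle.ext this
    generalize c₂ + β c₂ = z at this ⊢
    generalize c₁ + β c₁ = y at this ⊢
    rw [AddChar.sub_apply', AddChar.add_apply, AddChar.add_apply, adjointEquiv_apply,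
      mul_comm (θ z), ← mul_assoc] at this
    rw [div_eq_mul_inv, mul_comm (θ z)] at this
    rw [two_nsmul, AddChar.map_add_eq_mul, AddChar.map_add_eq_mul]
    have h3 := mul_right_cancel this
    rw [eq_inv_iff_mul_eq_one] at h3
    rw [← h3]
    generalize θ y = p
    generalize θ (β z) = q
    rw [mul_mul_mul_comm, mul_assoc (p * p)]
  have hmem : ∀ g : G, g ∈ kerIdAdd β ↔ g + β g = 0 := fun g => by
    simp [kerIdAdd, AddMonoidHom.mem_ker]
  have hms : ∀ g : G, Measurable fun x : ℝ × ZMod 2 × G => x - (0, 0, g) := fun g => by fun_prop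
  have hset : MeasurableSet {x : ℝ × ZMod 2 × G | x.2.2 ∈ kerIdAdd β} :=
    (by fun_prop : Measurable fun x : ℝ × ZMod 2 × G => x.2.2) (Set.toFinite _).measurableSet
  -- Translations by `g₁`, `g₂` with `g₁ + βg₂ = 0` preserve the Heyde equation. With `g₂ = c₂`, the
  -- identity `hc` makes the resulting `g₁` suitable for `μ₁` as well.
  refine ⟨-β c₂, c₂, ?_, ?_, ?_⟩
  · intro s t n ψ φ
    have hcancel : ∀ p q r : Circle, p * q * (r * q)⁻¹ = p * q⁻¹ * (r * q⁻¹)⁻¹ := by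
      intro p q r
      rw [mul_inv, mul_inv, inv_inv, mul_mul_mul_comm, mul_inv_cancel, mul_mul_mul_comm,
        inv_mul_cancel]
    have key : (ψ + φ) (-(-β c₂)) * (ψ + adjointEquiv β φ) (-c₂) =
        (ψ - φ) (-(-β c₂)) * (ψ - adjointEquiv β φ) (-c₂) := by
      simp only [AddChar.add_apply, AddChar.sub_apply', adjointEquiv_apply, neg_neg,
        AddChar.map_neg_eq_inv, div_eq_mul_inv]
      exact hcancel _ _ _
    have key' := congrArg (fun z : Circle => (z : ℂ)) key
    simp only [Circle.coe_mul] at key'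
    simp only [charFn_map_sub]
    linear_combination (((ψ + φ) (-(-β c₂)) : ℂ) * ((ψ + adjointEquiv β φ) (-c₂) : ℂ)) *
      h s t n ψ φ + charFn μ₁ (charX (s - t) n (ψ - φ)) *
        charFn μ₂ (charX (s - a * t) n (ψ - adjointEquiv β φ)) * key'
  · rw [ae_map_iff (hms _).aemeasurable hset]
    filter_upwards [hc1] with x hx
    simp only [hmem, Prod.snd_sub, sub_neg_eq_add, map_add]
    rw [map_add] at hc
    rw [← hc, ← hx]
    abel
  · rw [ae_map_iff (hms _).aemeasurable hset]
    filter_upwards [hc2] with x hx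
    simp only [hmem, Prod.snd_sub, map_sub]
    rw [← sub_eq_zero] at hx
    rw [← hx]
    abel

end

/-! ### The reduced equation and its Gaussian projections -/

section

variable {G : Type*} [AddCommGroup G] [MeasurableSpace G]

/-- The Heyde equation for measures concentrated on `ℝ × ℤ(2) × Ker (I + β)`, where `β` acts as
`-I`. -/
lemma HeydeEq.reduced [Finite G] (hG : ∀ g : G, addOrderOf g ≠ 2) {a : ℝ} {β : G ≃+ G}
    {μ₁ μ₂ : Measure (ℝ × ZMod 2 × G)} (h : HeydeEq a β μ₁ μ₂)
    (hK : ∀ᵐ x ∂μ₂, x.2.2 ∈ kerIdAdd β) (s t : ℝ) (n : ZMod 2) (p q : AddChar G Circle) :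
    charFn μ₁ (charX (s + t) n p) * charFn μ₂ (charX (s + a * t) n q) =
      charFn μ₁ (charX (s - t) n q) * charFn μ₂ (charX (s - a * t) n p) := by
  have hadj : ∀ x : ℝ × ZMod 2 × G, x.2.2 ∈ kerIdAdd β → ∀ φ : AddChar G Circle,
      adjointEquiv β φ x.2.2 = (-φ) x.2.2 := by
    intro x hx φ
    have hx' : x.2.2 + β x.2.2 = 0 := by simpa [kerIdAdd, AddMonoidHom.mem_ker] using hx
    rw [adjointEquiv_apply, AddChar.neg_apply, neg_eq_of_add_eq_zero_right hx']
  have e1 : ∀ (s : ℝ) (ψ φ : AddChar G Circle),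
      charFn μ₂ (charX s n (ψ + adjointEquiv β φ)) = charFn μ₂ (charX s n (ψ - φ)) := by
    intro s ψ φ
    refine integral_congr_ae ?_
    filter_upwards [hK] with x hx
    rw [charX_apply, charX_apply, AddChar.add_apply, hadj x hx, sub_eq_add_neg, AddChar.add_apply]
  have e2 : ∀ (s : ℝ) (ψ φ : AddChar G Circle),
      charFn μ₂ (charX s n (ψ - adjointEquiv β φ)) = charFn μ₂ (charX s n (ψ + φ)) := by
    intro s ψ φ
    rw [sub_eq_add_neg, ← map_neg, e1, sub_neg_eq_add]
  obtain ⟨p', rfl⟩ := surjective_two_nsmul_addChar hG p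
  obtain ⟨q', rfl⟩ := surjective_two_nsmul_addChar hG q
  -- With `ψ = p' + q'` and `φ = p' - q'` one has `ψ + φ = p` and `ψ - φ = q`. On the kernel the
  -- adjoint changes the sign of `φ`, which swaps `p` and `q` in the second factors.
  have := h s t n (p' + q') (p' - q')
  rw [e1, e2] at this
  have a1 : p' + q' + (p' - q') = 2 • p' := by abel
  have a2 : p' + q' - (p' - q') = 2 • q' := by abel
  rwa [a1, a2] at this

lemma continuous_charFn_charX [Finite G] [MeasurableSingletonClass G]
    (μ : Measure (ℝ × ZMod 2 × G)) [IsFiniteMeasure μ] (n : ZMod 2) (ψ : AddChar G Circle) :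
    Continuous fun s => charFn μ (charX s n ψ) := by
  refine continuous_of_dominated (bound := fun _ => 1)
    (fun s => (measurable_charX s n ψ).aestronglyMeasurable)
    (fun s => Filter.Eventually.of_forall fun _ => (Circle.norm_coe _).le) (integrable_const 1)
    (Filter.Eventually.of_forall fun x => ?_)
  simp only [charX_apply, Circle.coe_mul, charRZ2_apply]
  fun_prop

lemma charFn_charX_one_real (μ : Measure (ℝ × ZMod 2 × G)) (n : ZMod 2) :
    (((charFn μ (charX 0 n 0)).re : ℝ) : ℂ) = charFn μ (charX 0 n 0) := by
  have := charFn_charX_neg μ 0 n 0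
  rw [neg_zero, neg_zero] at this
  exact Complex.conj_eq_iff_re.1 this.symm

/-- If all mean values of the characters `e^{its}` have modulus one, then the first coordinate is
degenerate. -/
lemma charFn_charX_of_norm_eq_one (μ : Measure (ℝ × ZMod 2 × G)) [IsProbabilityMeasure μ]
    (h : ∀ s, ‖charFn μ (charX s 0 0)‖ = 1) (s t : ℝ) (n : ZMod 2) :
    charFn μ (charX (s + t) n 0) = charFn μ (charX s 0 0) * charFn μ (charX t n 0) := by
  have hae := ae_eq_charFn_of_norm_eq_one μ (h s)
  rw [charFn, charFn.eq_1 μ (charX t n 0), ← integral_const_mul]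
  refine integral_congr_ae ?_
  filter_upwards [hae] with x hx
  rw [← hx, ← Circle.coe_mul, ← charX_add, zero_add, zero_add]

variable [Finite G] [MeasurableSingletonClass G]

lemma gaussian_form_of_norm_eq_one (μ : Measure (ℝ × ZMod 2 × G)) [IsProbabilityMeasure μ]
    (h : ∀ s, ‖charFn μ (charX s 0 0)‖ = 1) :
    ∃ σ σ' m m' : ℝ, 0 ≤ σ ∧ 0 ≤ σ' ∧
      (∀ s : ℝ, charFn μ (charX s 0 0) = Complex.exp (-σ * s ^ 2 + Complex.I * m * s)) ∧
      (∀ s : ℝ, charFn μ (charX s 1 0) =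
        charFn μ (charX 0 1 0) * Complex.exp (-σ' * s ^ 2 + Complex.I * m' * s)) := by
  have hmul := charFn_charX_of_norm_eq_one μ h
  have hne : ∀ s, charFn μ (charX s 0 0) ≠ 0 := fun s h0 => by
    have := h s
    rw [h0, norm_zero] at this
    exact zero_ne_one this
  have h00 := charFn_charX_zero μ
  have hsub : ∀ s t, charFn μ (charX (s - t) 0 0) =
      charFn μ (charX s 0 0) * (charFn μ (charX t 0 0))⁻¹ := by
    intro s t
    rw [eq_mul_inv_iff_mul_eq₀ (hne t), ← hmul, sub_add_cancel]
  -- A multiplicative `f` solves the Heyde equation with `a = 2` when paired with `s ↦ f(s/2)⁻¹`, so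
  -- the general lemma applies to this degenerate case.
  obtain ⟨σ, m, hσ, hf⟩ := gaussian_of_heyde (a := 2) (by norm_num) (by norm_num)
    (φ₁ := fun s => charFn μ (charX s 0 0)) (φ₂ := fun s => (charFn μ (charX (s / 2) 0 0))⁻¹)
    (continuous_charFn_charX μ 0 0)
    (((continuous_charFn_charX μ 0 0).comp (continuous_id.div_const 2)).inv₀ fun s => hne _)
    hne (fun s => inv_ne_zero (hne _)) (by
      intro s t
      rw [show (s + 2 * t) / 2 = s / 2 + t by ring, show (s - 2 * t) / 2 = s / 2 - t by ring,
        hsub, hsub, hmul, hmul]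
      have := hne t
      have := hne (s / 2)
      field_simp)
    (fun s => by simpa using charFn_charX_neg μ s 0 0) (fun s => norm_charFn_le_one _ _)
  simp only [h00, one_mul] at hf
  refine ⟨σ, σ, m, m, hσ, hσ, hf, fun s => ?_⟩
  rw [← hf, mul_comm, ← hmul, add_zero]

/-- The characteristic functions of the projections on `ℝ × ℤ(2)` are of Gaussian type. -/
lemma gaussian_form_of_reduced {a : ℝ} (ha0 : a ≠ 0) (ha : a ≠ -1)
    {μ₁ μ₂ : Measure (ℝ × ZMod 2 × G)} [IsProbabilityMeasure μ₁] [IsProbabilityMeasure μ₂]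
    (h1 : ∀ s n ψ, charFn μ₁ (charX s n ψ) ≠ 0) (h2 : ∀ s n ψ, charFn μ₂ (charX s n ψ) ≠ 0)
    (h : ∀ (s t : ℝ) (n : ZMod 2),
      charFn μ₁ (charX (s + t) n 0) * charFn μ₂ (charX (s + a * t) n 0) =
        charFn μ₁ (charX (s - t) n 0) * charFn μ₂ (charX (s - a * t) n 0)) :
    ∃ σ σ' m m' : ℝ, 0 ≤ σ ∧ 0 ≤ σ' ∧
      (∀ s : ℝ, charFn μ₁ (charX s 0 0) = Complex.exp (-σ * s ^ 2 + Complex.I * m * s)) ∧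
      (∀ s : ℝ, charFn μ₁ (charX s 1 0) =
        charFn μ₁ (charX 0 1 0) * Complex.exp (-σ' * s ^ 2 + Complex.I * m' * s)) := by
  by_cases ha1 : a = 1
  · subst ha1
    refine gaussian_form_of_norm_eq_one μ₁ fun s => ?_
    -- For `a = 1` this reads `f₁(s) f₂(s) = 1`; since both moduli are at most one, both equal one.
    have := h (s / 2) (s / 2) 0
    rw [one_mul, sub_self, add_halves, charFn_charX_zero, charFn_charX_zero] at this
    have e := congrArg norm this
    rw [norm_mul, norm_mul, norm_one, one_mul] at e
    have b1 := norm_charFn_le_one μ₁ (charX s 0 0)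
    have b2 := norm_charFn_le_one μ₂ (charX s 0 0)
    nlinarith [norm_nonneg (charFn μ₁ (charX s 0 0)), norm_nonneg (charFn μ₂ (charX s 0 0))]
  · have key := fun n => gaussian_of_heyde ha1 ha (φ₁ := fun s => charFn μ₁ (charX s n 0))
      (φ₂ := fun s => charFn μ₂ (charX s n 0)) (continuous_charFn_charX μ₁ n 0)
      (continuous_charFn_charX μ₂ n 0) (fun s => h1 s n 0) (fun s => h2 s n 0)
      (fun s t => h s t n) (fun s => by simpa using charFn_charX_neg μ₁ s n 0)
      (fun s => norm_charFn_le_one _ _)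
    obtain ⟨σ, m, hσ, hf⟩ := key 0
    obtain ⟨σ', m', hσ', hf'⟩ := key 1
    simp only [charFn_charX_zero, one_mul] at hf
    exact ⟨σ, σ', m, m', hσ, hσ', hf, hf'⟩

end

/-! ### Distributions on `ℤ(2)` and factors taken from it -/

/-- The distribution on `ℤ(2)` whose characteristic function takes the value `c` at the nontrivial
character. -/
noncomputable def z2Measure (c : ℝ) : Measure (ZMod 2) :=
  ENNReal.ofReal ((1 + c) / 2) • Measure.dirac 0 + ENNReal.ofReal ((1 - c) / 2) • Measure.dirac 1

lemma isProbabilityMeasure_z2Measure {c : ℝ} (hc : |c| ≤ 1) :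
    IsProbabilityMeasure (z2Measure c) := by
  have := abs_le.1 hc
  refine ⟨?_⟩
  simp only [z2Measure, Measure.coe_add, Measure.coe_smul, Pi.add_apply, Pi.smul_apply,
    measure_univ, smul_eq_mul, mul_one]
  rw [← ENNReal.ofReal_add (by linarith) (by linarith)]
  ring_nf
  exact ENNReal.ofReal_one

lemma integral_z2Measure {c : ℝ} (hc : |c| ≤ 1) (f : ZMod 2 → ℂ) :
    ∫ m, f m ∂z2Measure c = (1 + c) / 2 * f 0 + (1 - c) / 2 * f 1 := by
  have := abs_le.1 hc
  have hint : ∀ (r : ℝ) (k : ZMod 2), Integrable f (ENNReal.ofReal r • Measure.dirac k) :=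
    fun r k => ((integrable_dirac (by simp)).smul_measure ENNReal.ofReal_ne_top)
  rw [z2Measure, integral_add_measure (hint _ _) (hint _ _), integral_smul_measure,
    integral_smul_measure, integral_dirac, integral_dirac, ENNReal.toReal_ofReal (by linarith),
    ENNReal.toReal_ofReal (by linarith)]
  simp [Complex.real_smul]

section

variable {G : Type*} [AddCommGroup G] [MeasurableSpace G]

/-- A retraction of `ℝ × ℤ(2) × G` onto `ℝ × ℤ(2) × K`. -/
noncomputable def retractRZ2K (K : AddSubgroup G) (x : ℝ × ZMod 2 × G) : ℝ × ZMod 2 × K :=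
  open Classical in (x.1, x.2.1, if h : x.2.2 ∈ K then ⟨x.2.2, h⟩ else 0)

lemma measurable_retractRZ2K [Finite G] [MeasurableSingletonClass G] (K : AddSubgroup G) :
    Measurable (retractRZ2K K) := by
  classical
  have : Measurable fun g : G => if h : g ∈ K then (⟨g, h⟩ : K) else 0 := measurable_of_countable _
  exact measurable_fst.prodMk ((measurable_fst.comp measurable_snd).prodMk
    (this.comp (measurable_snd.comp measurable_snd)))

lemma ofRZ2K_map_retract [Finite G] [MeasurableSingletonClass G] {K : AddSubgroup G}
    {μ : Measure (ℝ × ZMod 2 × G)} (h : ∀ᵐ x ∂μ, x.2.2 ∈ K) :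
    ofRZ2K (μ.map (retractRZ2K K)) = μ := by
  rw [ofRZ2K, Measure.map_map (by fun_prop) (measurable_retractRZ2K K)]
  conv_rhs => rw [← Measure.map_id (μ := μ)]
  refine Measure.map_congr ?_
  filter_upwards [h] with x hx
  simp [retractRZ2K, hx]

variable [Finite G] [TopologicalSpace G] [DiscreteTopology G] [BorelSpace G]

lemma ofRZ2K_injective (K : AddSubgroup G) :
    Function.Injective (ofRZ2K : Measure (ℝ × ZMod 2 × K) → _) := by
  refine Function.LeftInverse.injective (g := fun μ => μ.map (retractRZ2K K)) fun ω => ?_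
  change (ofRZ2K ω).map (retractRZ2K K) = ω
  rw [ofRZ2K, Measure.map_map (measurable_retractRZ2K K) (by fun_prop)]
  conv_rhs => rw [← Measure.map_id (μ := ω)]
  congr 1
  funext x
  simp [retractRZ2K]

/-- Convolution with `z2Measure c` multiplies the characteristic function by `1` for `n = 0` and by
`c` for `n = 1`. Uniqueness is applied in `ℝ × ℤ(2) × G`, and the equality is carried back by
injectivity of the push-forward. -/
lemma eq_conv_of_ofRZ2K {K : AddSubgroup G} {ω₁ ω₂ : Measure (ℝ × ZMod 2 × K)}
    [IsFiniteMeasure ω₁] [IsFiniteMeasure ω₂] {c : ℝ} (hc : |c| ≤ 1)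
    (h0 : ∀ s ψ, charFn (ofRZ2K ω₁) (charX s 0 ψ) = charFn (ofRZ2K ω₂) (charX s 0 ψ))
    (h1 : ∀ s ψ, charFn (ofRZ2K ω₁) (charX s 1 ψ) = c * charFn (ofRZ2K ω₂) (charX s 1 ψ)) :
    ω₁ = ω₂ ∗ (z2Measure c).map fun m => (0, m, 0) := by
  have := isProbabilityMeasure_z2Measure hc
  have : IsFiniteMeasure (ofRZ2K ω₁) := by unfold ofRZ2K; infer_instance
  have : IsFiniteMeasure (ofRZ2K ω₂) := by unfold ofRZ2K; infer_instance
  apply ofRZ2K_injective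
  let ι : (ℝ × ZMod 2 × K) →+ (ℝ × ZMod 2 × G) :=
    (AddMonoidHom.id ℝ).prodMap ((AddMonoidHom.id (ZMod 2)).prodMap K.subtype)
  have hι : ∀ ω : Measure (ℝ × ZMod 2 × K), ofRZ2K ω = ω.map ι := fun ω => rfl
  have hιm : Measurable ι :=
    (by fun_prop : Measurable fun x : ℝ × ZMod 2 × K => (x.1, x.2.1, (x.2.2 : G)))
  have e : ofRZ2K (ω₂ ∗ (z2Measure c).map fun m => (0, m, 0)) =
      ofRZ2K ω₂ ∗ (z2Measure c).map fun m => (0, m, 0) := by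
    rw [hι, Measure.map_conv_addMonoidHom ι hιm, Measure.map_map hιm (by fun_prop)]
    congr 1
  rw [e]
  refine ext_of_charFn_charX fun s n ψ => ?_
  have hm := measurable_charX s n ψ
  rw [charFn_conv _ _ hm, charFn.eq_1 (Measure.map _ _),
    integral_map (by fun_prop) (by fun_prop), integral_z2Measure hc]
  have : ∀ n : ZMod 2, n = 0 ∨ n = 1 := by decide
  rcases this n with rfl | rfl
  · rw [h0]
    simp [charX_apply, charRZ2]
    ring
  · rw [h1]
    simp [charX_apply, charRZ2, toCircle_two_one]
    ring

/-- Two distributions on `ℝ × ℤ(2) × K` whose characteristic functions agree on the trivial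
character of `ℤ(2)` and are proportional on the nontrivial one are related by a distribution
on `ℤ(2)`. -/
lemma z2Related_of_charFn {K : AddSubgroup G} {ω₁ ω₂ : Measure (ℝ × ZMod 2 × K)}
    [IsFiniteMeasure ω₁] [IsFiniteMeasure ω₂] {r₁ r₂ : ℝ} (hr₁ : r₁ ≠ 0) (hr₂ : r₂ ≠ 0)
    (h0 : ∀ s ψ, charFn (ofRZ2K ω₁) (charX s 0 ψ) = charFn (ofRZ2K ω₂) (charX s 0 ψ))
    (h1 : ∀ s ψ, charFn (ofRZ2K ω₁) (charX s 1 ψ) * r₂ =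
      r₁ * charFn (ofRZ2K ω₂) (charX s 1 ψ)) :
    Z2Related (fun m => (0, m, 0)) ω₁ ω₂ := by
  have hr₁' : (r₁ : ℂ) ≠ 0 := by exact_mod_cast hr₁
  have hr₂' : (r₂ : ℂ) ≠ 0 := by exact_mod_cast hr₂
  rcases le_total |r₁| |r₂| with hle | hle
  · have hc : |r₁ / r₂| ≤ 1 := by rw [abs_div]; exact div_le_one_of_le₀ hle (abs_nonneg _)
    refine Or.inl ⟨z2Measure (r₁ / r₂), isProbabilityMeasure_z2Measure hc,
      eq_conv_of_ofRZ2K hc h0 fun s ψ => ?_⟩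
    push_cast
    rw [div_mul_eq_mul_div, eq_div_iff hr₂', h1]
  · have hc : |r₂ / r₁| ≤ 1 := by rw [abs_div]; exact div_le_one_of_le₀ hle (abs_nonneg _)
    refine Or.inr ⟨z2Measure (r₂ / r₁), isProbabilityMeasure_z2Measure hc,
      eq_conv_of_ofRZ2K hc (fun s ψ => (h0 s ψ).symm) fun s ψ => ?_⟩
    push_cast
    rw [div_mul_eq_mul_div, eq_div_iff hr₁', mul_comm _ (r₁ : ℂ), ← h1, mul_comm]

lemma map_sub_conv_dirac (μ : Measure (ℝ × ZMod 2 × G)) [IsFiniteMeasure μ] (y : ℝ × ZMod 2 × G) :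
    (μ.map fun x => x - y) ∗ Measure.dirac y = μ := by
  rw [Measure.conv_dirac, Measure.map_map (by fun_prop) (by fun_prop)]
  conv_rhs => rw [← Measure.map_id (μ := μ)]
  congr 1
  funext x
  simp

end

/-! ### Splitting off a factor of class `Θ` -/

/-- The difference of the masses of the two slices of a measure on `ℝ × ℤ(2)`. -/
noncomputable def massDiff (γ : Measure (ℝ × ZMod 2)) : ℝ :=
  (slice γ 0).real Set.univ - (slice γ 1).real Set.univ

lemma charFn_charRZ2_zero_zero (γ : Measure (ℝ × ZMod 2)) :
    charFn γ (charRZ2 0 0) = (γ.real Set.univ : ℝ) := by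
  simp [charFn, charRZ2]

lemma charFn_charRZ2_zero_one (γ : Measure (ℝ × ZMod 2)) [IsFiniteMeasure γ] :
    charFn γ (charRZ2 0 1) = massDiff γ := by
  rw [charFn_charRZ2_eq, toCircle_two_one, charFun_zero, charFun_zero, massDiff]
  push_cast
  ring

lemma abs_massDiff_le (γ : Measure (ℝ × ZMod 2)) [IsFiniteMeasure γ] :
    |massDiff γ| ≤ γ.real Set.univ := by
  rw [← Real.norm_eq_abs, ← Complex.norm_real, ← charFn_charRZ2_zero_one]
  refine (norm_integral_le_of_norm_le_const (C := 1)
    (Filter.Eventually.of_forall fun _ => (Circle.norm_coe _).le)).trans ?_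
  simp

section

variable {G : Type*} [AddCommGroup G] [Fintype G] [MeasurableSpace G] [MeasurableSingletonClass G]

/-- A distribution on `ℤ(2) × K` with prescribed Fourier coefficients in the direction of `ℤ(2)`. -/
lemma exists_measure_Z2K {K : AddSubgroup G} {B D : G → ℝ} (hD : ∀ k, |D k| ≤ B k)
    (hK : ∀ k, k ∉ K → B k = 0) (hB : ∑ k, B k = 1) :
    ∃ ω : Measure (ZMod 2 × K), IsProbabilityMeasure ω ∧
      (∀ s ψ, charFn (ofZ2K ω) (charX s 0 ψ) = ∑ k, (ψ k : ℂ) * B k) ∧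
      ∀ s ψ, charFn (ofZ2K ω) (charX s 1 ψ) = ∑ k, (ψ k : ℂ) * D k := by
  classical
  have hB0 : ∀ k, 0 ≤ B k := fun k => (abs_nonneg _).trans (hD k)
  have hDB : ∀ k, D k / B k * B k = D k := by
    intro k
    rcases (hB0 k).eq_or_lt with h | h
    · have := hD k
      rw [← h] at this
      rw [abs_nonpos_iff.1 this, zero_div, zero_mul]
    · rw [div_mul_cancel₀ _ h.ne']
  have hc : ∀ k, |D k / B k| ≤ 1 := fun k => by
    rw [abs_div, abs_of_nonneg (hB0 k)]
    exact div_le_one_of_le₀ (hD k) (hB0 k)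
  have hprob := fun k => isProbabilityMeasure_z2Measure (hc k)
  have hsum : ∀ {M : Type} [AddCommMonoid M] (f : G → M), (∀ k, k ∉ K → f k = 0) →
      ∑ k : K, f k = ∑ k, f k := by
    intro M _ f hf
    rw [← Finset.sum_subtype (Finset.univ.filter (· ∈ K)) (by simp) f, Finset.sum_filter_of_ne]
    exact fun k _ hk => by_contra fun hkK => hk (hf k hkK)
  -- Over `k` the measure has mass `B k` and difference `D k` of its two atoms. Where `B k = 0` also
  -- `D k = 0`, and the convention `0 / 0 = 0` is harmless.
  set ν : K → Measure (ZMod 2 × K) := fun k =>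
    ENNReal.ofReal (B k) • (z2Measure (D k / B k)).map fun m => (m, k) with hν
  have hfin : ∀ k, IsFiniteMeasure (ν k) := fun k => by
    have := Measure.isFiniteMeasure_map (z2Measure (D k / B k)) fun m => (m, k)
    exact Measure.smul_finite _ ENNReal.ofReal_ne_top
  have hchar : ∀ s n (ψ : AddChar G Circle), charFn (ofZ2K (∑ k, ν k)) (charX s n ψ) =
      ∑ k : K, (ψ k : ℂ) * (B k * ∫ m, (ZMod.toCircle (m * n) : ℂ) ∂z2Measure (D k / B k)) := by
    intro s n ψ
    have hm := measurable_charX s n ψ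
    have hm2 : Measurable fun x : ZMod 2 × K => (charX s n ψ ((0 : ℝ), x.1, (x.2 : G)) : ℂ) := by
      fun_prop
    rw [charFn, ofZ2K, integral_map (by fun_prop) hm.aestronglyMeasurable,
      integral_finsetSum_measure fun k _ => Integrable.of_bound hm2.aestronglyMeasurable 1
        (Filter.Eventually.of_forall fun _ => (Circle.norm_coe _).le)]
    refine Finset.sum_congr rfl fun k _ => ?_
    rw [hν]
    simp only
    rw [integral_smul_measure, integral_map (by fun_prop) (by fun_prop),
      ENNReal.toReal_ofReal (hB0 k), Complex.real_smul, mul_left_comm,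
      ← integral_const_mul (ψ k : ℂ)]
    congr 2
    funext m
    simp [charX_apply, charRZ2, mul_comm]
  refine ⟨∑ k, ν k, ⟨?_⟩, fun s ψ => ?_, fun s ψ => ?_⟩
  · rw [Measure.coe_finsetSum, Finset.sum_apply]
    have : ∀ k : K, ν k Set.univ = ENNReal.ofReal (B k) := by
      intro k
      simp only [hν, Measure.smul_apply, smul_eq_mul]
      rw [Measure.map_apply (by fun_prop) MeasurableSet.univ, Set.preimage_univ, measure_univ,
        mul_one]
    simp only [this]
    rw [hsum (fun k => ENNReal.ofReal (B k)) fun k hk => by rw [hK k hk, ENNReal.ofReal_zero],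
      ← ENNReal.ofReal_sum_of_nonneg fun k _ => hB0 k, hB, ENNReal.ofReal_one]
  · rw [hchar, ← hsum (fun k => (ψ k : ℂ) * B k) fun k hk => by rw [hK k hk]; simp]
    refine Finset.sum_congr rfl fun k _ => ?_
    simp
  · rw [hchar, ← hsum (fun k => (ψ k : ℂ) * D k) fun k hk => by
      rw [← hDB k, hK k hk]; simp]
    refine Finset.sum_congr rfl fun k _ => ?_
    rw [integral_z2Measure (hc k)]
    simp only [mul_one, AddChar.map_zero_eq_one, Circle.coe_one, toCircle_two_one]
    have e : (D k : ℂ) = D k / B k * B k := by exact_mod_cast (hDB k).symm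
    conv_rhs => rw [e]
    push_cast
    ring

/-- A distribution whose fibres over `G` are proportional splits off the class `Θ`. -/
lemma exists_classTheta_factor [TopologicalSpace G] [DiscreteTopology G] [BorelSpace G]
    {K : AddSubgroup G} {μ : Measure (ℝ × ZMod 2 × G)}
    [IsProbabilityMeasure μ]
    (hfac : ∀ s n k, charFn (fibre μ k) (charRZ2 s n) * charFn μ (charX 0 n 0) =
      charFn μ (charX s n 0) * charFn (fibre μ k) (charRZ2 0 n))
    (hne : charFn μ (charX 0 1 0) ≠ 0)
    (hgauss : ∃ σ σ' m m' : ℝ, 0 ≤ σ ∧ 0 ≤ σ' ∧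
      (∀ s : ℝ, charFn μ (charX s 0 0) = Complex.exp (-σ * s ^ 2 + Complex.I * m * s)) ∧
      (∀ s : ℝ, charFn μ (charX s 1 0) =
        charFn μ (charX 0 1 0) * Complex.exp (-σ' * s ^ 2 + Complex.I * m' * s)))
    {k₀ : G} (hk : massDiff (fibre μ k₀) ≠ 0) {ω : Measure (ZMod 2 × K)} [IsFiniteMeasure ω]
    (h0 : ∀ s ψ, charFn (ofZ2K ω) (charX s 0 ψ) =
      ∑ k, (ψ k : ℂ) * ((fibre μ k).real Set.univ : ℝ))
    (h1 : ∀ s ψ, charFn (ofZ2K ω) (charX s 1 ψ) * (massDiff (fibre μ k₀) : ℝ) =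
      ∑ k, (ψ k : ℂ) * (massDiff (fibre μ k) : ℝ) * ((fibre μ k₀).real Set.univ : ℝ)) :
    ∃ γ : Measure (ℝ × ZMod 2), ClassTheta γ ∧ μ = ofRZ2 G γ ∗ ofZ2K ω := by
  obtain ⟨σ, σ', m, m', hσ, hσ', hg0, hg1⟩ := hgauss
  set b := (fibre μ k₀).real Set.univ with hb
  have hbpos : 0 < b := (abs_pos.2 hk).trans_le (abs_massDiff_le _)
  have hbC : (b : ℂ) ≠ 0 := by exact_mod_cast hbpos.ne'
  have hkC : (massDiff (fibre μ k₀) : ℂ) ≠ 0 := by exact_mod_cast hk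
  -- As a normalised piece of `μ`, this is positive from the outset; only its characteristic
  -- function has to be identified.
  set γ := ENNReal.ofReal b⁻¹ • fibre μ k₀ with hγ
  have hγchar : ∀ s n, charFn γ (charRZ2 s n) = (b : ℂ)⁻¹ * charFn (fibre μ k₀) (charRZ2 s n) := by
    intro s n
    rw [hγ, charFn, integral_smul_measure, ENNReal.toReal_ofReal (by positivity),
      Complex.real_smul, Complex.ofReal_inv]
    rfl
  have hγprob : IsProbabilityMeasure γ := by
    refine ⟨?_⟩
    rw [hγ, Measure.smul_apply, smul_eq_mul, ← ofReal_measureReal, ← hb,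
      ← ENNReal.ofReal_mul (by positivity), inv_mul_cancel₀ hbpos.ne', ENNReal.ofReal_one]
  have hF0 : ∀ s k, charFn (fibre μ k) (charRZ2 s 0) =
      charFn μ (charX s 0 0) * ((fibre μ k).real Set.univ : ℝ) := by
    intro s k
    have := hfac s 0 k
    rwa [charFn_charX_zero, mul_one, charFn_charRZ2_zero_zero] at this
  have hF1 : ∀ s k, charFn (fibre μ k) (charRZ2 s 1) =
      Complex.exp (-σ' * s ^ 2 + Complex.I * m' * s) * (massDiff (fibre μ k) : ℝ) := by
    intro s k
    have := hfac s 1 k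
    rw [hg1 s, charFn_charRZ2_zero_one] at this
    refine mul_right_cancel₀ hne ?_
    rw [this]
    ring
  have hγ0 : ∀ s, charFn γ (charRZ2 s 0) = charFn μ (charX s 0 0) := by
    intro s
    rw [hγchar, hF0, ← hb]
    field_simp
  have hγ1 : ∀ s : ℝ, charFn γ (charRZ2 s 1) = ((b⁻¹ * massDiff (fibre μ k₀) : ℝ) : ℂ) *
      Complex.exp (-σ' * s ^ 2 + Complex.I * m' * s) := by
    intro s
    rw [hγchar, hF1]
    push_cast
    ring
  refine ⟨γ, classTheta_of_charFn hσ hσ' (mul_ne_zero (inv_ne_zero hbpos.ne') hk)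
    (fun s => (hγ0 s).trans (hg0 s)) hγ1, ?_⟩
  have hofγ : ∀ s n ψ, charFn (ofRZ2 G γ) (charX s n ψ) = charFn γ (charRZ2 s n) := by
    intro s n ψ
    have hm := measurable_charX s n ψ
    rw [charFn, ofRZ2, integral_map (by fun_prop) (by fun_prop)]
    simp [charX_apply, charFn]
  have : IsFiniteMeasure (ofRZ2 G γ) := by unfold ofRZ2; infer_instance
  have : IsFiniteMeasure (ofZ2K ω) := by unfold ofZ2K; infer_instance
  refine ext_of_charFn_charX fun s n ψ => ?_
  rw [charFn_conv _ _ (measurable_charX s n ψ), hofγ, charFn_charX_eq_sum]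
  have : ∀ n : ZMod 2, n = 0 ∨ n = 1 := by decide
  rcases this n with rfl | rfl
  · rw [hγ0, h0, Finset.mul_sum]
    refine Finset.sum_congr rfl fun k _ => ?_
    rw [hF0]
    ring
  · refine mul_right_cancel₀ (mul_ne_zero hbC hkC) ?_
    have := h1 s ψ
    rw [hγ1, Finset.sum_mul]
    push_cast
    calc _ = ∑ k, Complex.exp (-σ' * s ^ 2 + Complex.I * m' * s) * massDiff (fibre μ k₀) *
          ((ψ k : ℂ) * (massDiff (fibre μ k) : ℝ) * b) := by
          refine Finset.sum_congr rfl fun k _ => ?_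
          rw [hF1]
          ring
      _ = _ := by
          rw [← Finset.mul_sum, ← this]
          field_simp

end

/-! ### Decomposition for `a ≠ -1` and proportionality for `a = -1` -/

/-- Separation of variables in the reduced Heyde equation for `a ≠ -1`. -/
lemma charFn_separate {G : Type*} [AddCommGroup G] [MeasurableSpace G] {a : ℝ} (ha : a ≠ -1) {μ₁ μ₂ : Measure (ℝ × ZMod 2 × G)}
    (h1 : ∀ s n ψ, charFn μ₁ (charX s n ψ) ≠ 0) (h2 : ∀ s n ψ, charFn μ₂ (charX s n ψ) ≠ 0)
    (h : ∀ (s t : ℝ) (n : ZMod 2) (p q : AddChar G Circle),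
      charFn μ₁ (charX (s + t) n p) * charFn μ₂ (charX (s + a * t) n q) =
        charFn μ₁ (charX (s - t) n q) * charFn μ₂ (charX (s - a * t) n p))
    (x y : ℝ) (n : ZMod 2) (p : AddChar G Circle) :
    charFn μ₁ (charX x n p) * charFn μ₂ (charX y n 0) =
      charFn μ₁ (charX x n 0) * charFn μ₂ (charX y n p) := by
  have ha' : 1 + a ≠ 0 := fun h => ha (by linarith)
  -- These `s`, `t` solve `s + t = x`, `s - at = y`. Comparing the equation for `(p, 0)` with that
  -- for `(0, 0)` eliminates the other two arguments.
  have e1 := h ((a * x + y) / (1 + a)) ((x - y) / (1 + a)) n p 0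
  have e2 := h ((a * x + y) / (1 + a)) ((x - y) / (1 + a)) n 0 0
  have hx : (a * x + y) / (1 + a) + (x - y) / (1 + a) = x := by field_simp; ring
  have hy : (a * x + y) / (1 + a) - a * ((x - y) / (1 + a)) = y := by field_simp; ring
  rw [hx, hy] at e1 e2
  generalize (a * x + y) / (1 + a) + a * ((x - y) / (1 + a)) = z at e1 e2
  generalize (a * x + y) / (1 + a) - (x - y) / (1 + a) = w at e1 e2
  refine mul_right_cancel₀ (mul_ne_zero (h2 z n 0) (h1 w n 0)) ?_
  linear_combination charFn μ₂ (charX y n 0) * charFn μ₁ (charX w n 0) * e1 -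
    charFn μ₁ (charX w n 0) * charFn μ₂ (charX y n p) * e2

lemma fibre_eq_zero {G : Type*} [AddCommGroup G] [MeasurableSpace G] {K : AddSubgroup G} {μ : Measure (ℝ × ZMod 2 × G)}
    (h : ∀ᵐ x ∂μ, x.2.2 ∈ K) {k : G} (hk : k ∉ K) : fibre μ k = 0 := by
  have : μ ((fun x => x.2.2) ⁻¹' {k}) = 0 := by
    refine measure_mono_null ?_ (ae_iff.1 h)
    intro x hx hxK
    exact hk ((show x.2.2 = k from hx) ▸ hxK)
  rw [fibre, Measure.restrict_eq_zero.2 this, Measure.map_zero]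

section

variable {G : Type*} [AddCommGroup G] [Finite G] [TopologicalSpace G] [DiscreteTopology G]
  [MeasurableSpace G] [BorelSpace G]

/-- Fibrewise form of the separation of variables. -/
lemma charFn_fibre_separate {μ₁ μ₂ : Measure (ℝ × ZMod 2 × G)} [IsFiniteMeasure μ₁]
    [IsFiniteMeasure μ₂]
    (h : ∀ (x y : ℝ) (n : ZMod 2) (p : AddChar G Circle),
      charFn μ₁ (charX x n p) * charFn μ₂ (charX y n 0) =
        charFn μ₁ (charX x n 0) * charFn μ₂ (charX y n p))
    (x y : ℝ) (n : ZMod 2) (k : G) :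
    charFn (fibre μ₁ k) (charRZ2 x n) * charFn μ₂ (charX y n 0) =
      charFn μ₁ (charX x n 0) * charFn (fibre μ₂ k) (charRZ2 y n) := by
  have := Fintype.ofFinite G
  have := finite_addChar_circle (G := G)
  have := Fintype.ofFinite (AddChar G Circle)
  rw [charFn_fibre_eq_sum, charFn_fibre_eq_sum, mul_assoc, mul_left_comm (charFn μ₁ _)]
  congr 1
  rw [Finset.sum_mul, Finset.mul_sum]
  refine Finset.sum_congr rfl fun ψ _ => ?_
  linear_combination (ψ (-k) : ℂ) * h x y n ψ

/-- Decomposition of the solutions of the reduced Heyde equation for `a ≠ -1`. -/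
lemma exists_decomposition {a : ℝ} (ha0 : a ≠ 0) (ha : a ≠ -1) {K : AddSubgroup G}
    {μ₁ μ₂ : Measure (ℝ × ZMod 2 × G)} [IsProbabilityMeasure μ₁] [IsProbabilityMeasure μ₂]
    (h1 : ∀ s n ψ, charFn μ₁ (charX s n ψ) ≠ 0) (h2 : ∀ s n ψ, charFn μ₂ (charX s n ψ) ≠ 0)
    (h : ∀ (s t : ℝ) (n : ZMod 2) (p q : AddChar G Circle),
      charFn μ₁ (charX (s + t) n p) * charFn μ₂ (charX (s + a * t) n q) =
        charFn μ₁ (charX (s - t) n q) * charFn μ₂ (charX (s - a * t) n p))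
    (hK : ∀ᵐ x ∂μ₁, x.2.2 ∈ K) :
    ∃ (γ₁ γ₂ : Measure (ℝ × ZMod 2)) (ω : Measure (ZMod 2 × K)),
      ClassTheta γ₁ ∧ ClassTheta γ₂ ∧ IsProbabilityMeasure ω ∧
      μ₁ = ofRZ2 G γ₁ ∗ ofZ2K ω ∧ μ₂ = ofRZ2 G γ₂ ∗ ofZ2K ω := by
  have := Fintype.ofFinite G
  have hsep := charFn_fibre_separate (charFn_separate ha h1 h2 h)
  have hg1 := gaussian_form_of_reduced ha0 ha h1 h2 fun s t n => h s t n 0 0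
  -- Replacing `t` by `a⁻¹t` exchanges the two distributions and turns `a` into `a⁻¹`.
  have hg2 := gaussian_form_of_reduced (inv_ne_zero ha0)
    (fun e => ha (by rw [← inv_inv a, e]; norm_num)) h2 h1 fun s t n => by
      have := h s (a⁻¹ * t) n 0 0
      rw [mul_inv_cancel_left₀ ha0] at this
      rw [mul_comm, this, mul_comm]
  have hB : ∀ k, (fibre μ₁ k).real Set.univ = (fibre μ₂ k).real Set.univ := by
    intro k
    have := hsep 0 0 0 k
    rw [charFn_charX_zero, charFn_charX_zero, mul_one, one_mul, charFn_charRZ2_zero_zero,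
      charFn_charRZ2_zero_zero] at this
    exact_mod_cast this
  have hD : ∀ k, (massDiff (fibre μ₁ k) : ℂ) * charFn μ₂ (charX 0 1 0) =
      charFn μ₁ (charX 0 1 0) * massDiff (fibre μ₂ k) := by
    intro k
    have := hsep 0 0 1 k
    rwa [charFn_charRZ2_zero_one, charFn_charRZ2_zero_one] at this
  have hfac1 : ∀ s n k, charFn (fibre μ₁ k) (charRZ2 s n) * charFn μ₁ (charX 0 n 0) =
      charFn μ₁ (charX s n 0) * charFn (fibre μ₁ k) (charRZ2 0 n) := by
    intro s n k
    refine mul_right_cancel₀ (h2 0 n 0) ?_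
    linear_combination charFn μ₁ (charX 0 n 0) * hsep s 0 n k -
      charFn μ₁ (charX s n 0) * hsep 0 0 n k
  have hfac2 : ∀ s n k, charFn (fibre μ₂ k) (charRZ2 s n) * charFn μ₂ (charX 0 n 0) =
      charFn μ₂ (charX s n 0) * charFn (fibre μ₂ k) (charRZ2 0 n) := by
    intro s n k
    refine mul_right_cancel₀ (h1 0 n 0) ?_
    linear_combination charFn μ₂ (charX s n 0) * hsep 0 0 n k -
      charFn μ₂ (charX 0 n 0) * hsep 0 s n k
  obtain ⟨k₀, hk₀⟩ := Finite.exists_max fun k =>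
    |massDiff (fibre μ₁ k)| / (fibre μ₁ k).real Set.univ
  have hbpos : ∀ k, massDiff (fibre μ₁ k) ≠ 0 → 0 < (fibre μ₁ k).real Set.univ := fun k hk =>
    (abs_pos.2 hk).trans_le (abs_massDiff_le _)
  -- Otherwise maximality would make every difference zero, and their sum is the nonvanishing value
  -- of `f₁` at `(0, 1, 0)`.
  have hk1 : massDiff (fibre μ₁ k₀) ≠ 0 := by
    intro hzero
    refine h1 0 1 0 ?_
    rw [charFn_charX_eq_sum]
    refine Finset.sum_eq_zero fun k _ => ?_
    rw [charFn_charRZ2_zero_one]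
    by_cases hk : massDiff (fibre μ₁ k) = 0
    · rw [hk]; simp
    · exfalso
      have := hk₀ k
      simp only [hzero, abs_zero, zero_div] at this
      exact this.not_gt (div_pos (abs_pos.2 hk) (hbpos k hk))
  have hk1C : (massDiff (fibre μ₁ k₀) : ℂ) ≠ 0 := by exact_mod_cast hk1
  have hk2 : massDiff (fibre μ₂ k₀) ≠ 0 := by
    intro hzero
    have := hD k₀
    rw [hzero, Complex.ofReal_zero, mul_zero] at this
    exact mul_ne_zero hk1C (h2 0 1 0) this
  have hb0 := hbpos k₀ hk1
  obtain ⟨ω, hω, hω0, hω1⟩ := exists_measure_Z2K (K := K)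
    (B := fun k => (fibre μ₁ k).real Set.univ)
    (D := fun k => massDiff (fibre μ₁ k) *
      ((fibre μ₁ k₀).real Set.univ / massDiff (fibre μ₁ k₀)))
    (by
      intro k
      by_cases hk : massDiff (fibre μ₁ k) = 0
      · simp [hk]
      · have := hk₀ k
        rw [div_le_div_iff₀ (hbpos k hk) hb0] at this
        rw [abs_mul, abs_div, abs_of_pos hb0, ← mul_div_assoc, div_le_iff₀ (abs_pos.2 hk1),
          mul_comm ((fibre μ₁ k).real Set.univ)]
        exact this)
    (fun k hk => by rw [fibre_eq_zero hK hk]; simp)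
    (by
      have := charFn_charX_eq_sum μ₁ 0 0 0
      rw [charFn_charX_zero] at this
      simp only [charFn_charRZ2_zero_zero, AddChar.zero_apply, Circle.coe_one, one_mul] at this
      exact_mod_cast this.symm)
  obtain ⟨γ₁, hγ1, hd1⟩ := exists_classTheta_factor hfac1 (h1 0 1 0) hg1 hk1 hω0 (by
    intro s ψ
    rw [hω1, Finset.sum_mul]
    refine Finset.sum_congr rfl fun k _ => ?_
    push_cast
    field_simp)
  obtain ⟨γ₂, hγ2, hd2⟩ := exists_classTheta_factor hfac2 (h2 0 1 0) hg2 hk2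
    (by simpa only [hB] using hω0) (by
    intro s ψ
    rw [hω1, Finset.sum_mul]
    refine Finset.sum_congr rfl fun k _ => ?_
    rw [← hB]
    -- By `hD` the differences for `μ₁` and `μ₂` are proportional with a factor independent of `k`,
    -- so the ratios to the value at `k₀` agree and one `ω` serves both.
    have e : (massDiff (fibre μ₁ k) : ℂ) * massDiff (fibre μ₂ k₀) =
        massDiff (fibre μ₂ k) * massDiff (fibre μ₁ k₀) := by
      refine mul_right_cancel₀ (mul_ne_zero (h1 0 1 0) (h2 0 1 0)) ?_
      linear_combination charFn μ₁ (charX 0 1 0) * massDiff (fibre μ₂ k₀) * hD k -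
        charFn μ₁ (charX 0 1 0) * massDiff (fibre μ₂ k) * hD k₀
    push_cast
    field_simp
    linear_combination (((fibre μ₁ k₀).real Set.univ : ℝ) : ℂ) * e)
  exact ⟨γ₁, γ₂, ω, hγ1, hγ2, hω, hd1, hd2⟩

lemma z2Related_self {A : Type*} [AddCommGroup A] [MeasurableSpace A] [MeasurableAdd₂ A]
    {i : ZMod 2 → A} (hi : i 0 = 0) (ω : Measure A) [SFinite ω] : Z2Related i ω ω := by
  refine Or.inl ⟨Measure.dirac 0, inferInstance, ?_⟩
  rw [Measure.map_dirac' (measurable_of_countable i), hi, Measure.conv_dirac_zero]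

/-- For `a = -1` the reduced Heyde equation makes the characteristic functions proportional on each
component. -/
lemma z2Related_of_reduced {K : AddSubgroup G} {μ₁ μ₂ : Measure (ℝ × ZMod 2 × G)}
    [IsProbabilityMeasure μ₁] [IsProbabilityMeasure μ₂]
    (h1 : ∀ s n ψ, charFn μ₁ (charX s n ψ) ≠ 0) (h2 : ∀ s n ψ, charFn μ₂ (charX s n ψ) ≠ 0)
    (h : ∀ (s t : ℝ) (n : ZMod 2) (p q : AddChar G Circle),
      charFn μ₁ (charX (s + t) n p) * charFn μ₂ (charX (s + -1 * t) n q) =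
        charFn μ₁ (charX (s - t) n q) * charFn μ₂ (charX (s - -1 * t) n p))
    (hK1 : ∀ᵐ x ∂μ₁, x.2.2 ∈ K) (hK2 : ∀ᵐ x ∂μ₂, x.2.2 ∈ K) :
    Z2Related (fun m => (0, m, 0)) (μ₁.map (retractRZ2K K)) (μ₂.map (retractRZ2K K)) := by
  have key : ∀ s n ψ, charFn μ₁ (charX s n ψ) * charFn μ₂ (charX 0 n 0) =
      charFn μ₁ (charX 0 n 0) * charFn μ₂ (charX s n ψ) := by
    intro s n ψ
    have := h (s / 2) (s / 2) n ψ 0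
    rwa [show s / 2 + s / 2 = s by ring, show s / 2 + -1 * (s / 2) = 0 by ring,
      show s / 2 - s / 2 = 0 by ring, show s / 2 - -1 * (s / 2) = s by ring] at this
  have r1 := charFn_charX_one_real μ₁ 1
  have r2 := charFn_charX_one_real μ₂ 1
  refine z2Related_of_charFn (r₁ := (charFn μ₁ (charX 0 1 0)).re)
    (r₂ := (charFn μ₂ (charX 0 1 0)).re) (fun e => h1 0 1 0 ?_) (fun e => h2 0 1 0 ?_) ?_ ?_
  · rw [← r1, e, Complex.ofReal_zero]
  · rw [← r2, e, Complex.ofReal_zero]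
  · intro s ψ
    rw [ofRZ2K_map_retract hK1, ofRZ2K_map_retract hK2]
    simpa [charFn_charX_zero] using key s 0 ψ
  · intro s ψ
    rw [ofRZ2K_map_retract hK1, ofRZ2K_map_retract hK2, r1, r2]
    exact key s 1 ψ

end

end HeydeLCA

/-! ### The theorem -/

theorem theorem3p1
    {G : Type*} [AddCommGroup G] [Finite G] [TopologicalSpace G] [DiscreteTopology G]
    [MeasurableSpace G] [BorelSpace G]
    (hG : ∀ g : G, addOrderOf g ≠ 2)
    (α : (ℝ × ZMod 2 × G) ≃ₜ+ (ℝ × ZMod 2 × G)) (a : ℝ) (αG : G ≃+ G)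
    (hα : ∀ (t : ℝ) (m : ZMod 2) (g : G), α (t, m, g) = (a * t, m, αG g))
    {Ω : Type*} [MeasurableSpace Ω] (P : Measure Ω) [IsProbabilityMeasure P]
    (ξ₁ ξ₂ : Ω → ℝ × ZMod 2 × G) (hξ₁ : Measurable ξ₁) (hξ₂ : Measurable ξ₂)
    (hindep : IndepFun ξ₁ ξ₂ P)
    (μ₁ μ₂ : Measure (ℝ × ZMod 2 × G)) (hμ₁ : μ₁ = P.map ξ₁) (hμ₂ : μ₂ = P.map ξ₂)
    (hchar₁ : HeydeLCA.NonvanishingCharFn μ₁) (hchar₂ : HeydeLCA.NonvanishingCharFn μ₂)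
    (hsymm : HeydeLCA.CondDistribSymmetric
      (fun w => ξ₁ w + α (ξ₂ w)) (fun w => ξ₁ w + ξ₂ w) P) :
    (a ≠ -1 →
      ∃ (γ₁ γ₂ : Measure (ℝ × ZMod 2))
        (ω₁ ω₂ : Measure (ZMod 2 × HeydeLCA.kerIdAdd αG)) (g₁ g₂ : G),
        HeydeLCA.ClassTheta γ₁ ∧ HeydeLCA.ClassTheta γ₂ ∧
        IsProbabilityMeasure ω₁ ∧ IsProbabilityMeasure ω₂ ∧
        HeydeLCA.Z2Related (fun m => (m, 0)) ω₁ ω₂ ∧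
        μ₁ = HeydeLCA.ofRZ2 G γ₁ ∗ HeydeLCA.ofZ2K ω₁ ∗ Measure.dirac (0, 0, g₁) ∧
        μ₂ = HeydeLCA.ofRZ2 G γ₂ ∗ HeydeLCA.ofZ2K ω₂ ∗ Measure.dirac (0, 0, g₂)) ∧
    (a = -1 →
      ∃ (ω₁ ω₂ : Measure (ℝ × ZMod 2 × HeydeLCA.kerIdAdd αG)) (x₁ x₂ : ℝ × ZMod 2 × G),
        IsProbabilityMeasure ω₁ ∧ IsProbabilityMeasure ω₂ ∧
        HeydeLCA.Z2Related (fun m => (0, m, 0)) ω₁ ω₂ ∧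
        μ₁ = HeydeLCA.ofRZ2K ω₁ ∗ Measure.dirac x₁ ∧
        μ₂ = HeydeLCA.ofRZ2K ω₂ ∗ Measure.dirac x₂) := by
  have hneg : ∀ (μ : Measure (ℝ × ZMod 2 × G)) (g : G), HeydeLCA.NonvanishingCharFn μ →
      ∀ s n ψ, HeydeLCA.charFn (μ.map fun x => x - (0, 0, g)) (HeydeLCA.charX s n ψ) ≠ 0 := by
    intro μ g h s n ψ
    rw [HeydeLCA.charFn_map_sub]
    exact mul_ne_zero (h _ (HeydeLCA.continuous_charX s n ψ)) (Circle.coe_ne_zero _)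
  have ha0 : a ≠ 0 := by
    rintro rfl
    have := α.injective ((hα 1 0 0).trans (by rw [zero_mul, ← zero_mul (0 : ℝ), hα 0 0 0]))
    simp at this
  have hαm : Measurable α := α.continuous.measurable
  have hp₁ : IsProbabilityMeasure μ₁ := hμ₁ ▸ Measure.isProbabilityMeasure_map hξ₁.aemeasurable
  have hp₂ : IsProbabilityMeasure μ₂ := hμ₂ ▸ Measure.isProbabilityMeasure_map hξ₂.aemeasurable
  have heq : HeydeLCA.HeydeEq a αG μ₁ μ₂ := by
    rw [hμ₁, hμ₂]
    exact HeydeLCA.heydeEq_of_map_prod_eq hξ₁ hξ₂ hindep (α := α) (fun x => hα x.1 x.2.1 x.2.2) hαm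
      (HeydeLCA.map_prod_eq_of_condDistribSymmetric (by fun_prop) (by fun_prop) hsymm)
  obtain ⟨g₁, g₂, hshift, hK1, hK2⟩ := HeydeLCA.exists_shift hG heq
    (fun s n ψ => hchar₁ _ (HeydeLCA.continuous_charX s n ψ))
    (fun s n ψ => hchar₂ _ (HeydeLCA.continuous_charX s n ψ))
  have hred := hshift.reduced hG hK2
  have hm : ∀ g : G, Measurable fun x : ℝ × ZMod 2 × G => x - (0, 0, g) := fun g => by fun_prop
  have hq₁ := Measure.isProbabilityMeasure_map (μ := μ₁) (hm g₁).aemeasurable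
  have hq₂ := Measure.isProbabilityMeasure_map (μ := μ₂) (hm g₂).aemeasurable
  refine ⟨fun ha => ?_, fun ha => ?_⟩
  · obtain ⟨γ₁, γ₂, ω, hγ1, hγ2, hω, hd1, hd2⟩ := HeydeLCA.exists_decomposition ha0 ha
      (hneg μ₁ g₁ hchar₁) (hneg μ₂ g₂ hchar₂) hred hK1
    have hfin : ∀ γ : Measure (ℝ × ZMod 2), IsProbabilityMeasure γ →
        IsFiniteMeasure (HeydeLCA.ofRZ2 G γ) := fun γ _ => by
      unfold HeydeLCA.ofRZ2; infer_instance
    have hfω : IsFiniteMeasure (HeydeLCA.ofZ2K ω) := by unfold HeydeLCA.ofZ2K; infer_instance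
    have := hfin γ₁ hγ1.1
    have := hfin γ₂ hγ2.1
    -- The `ℤ(2)` discrepancy between `μ₁` and `μ₂` is absorbed into `γ₁` and `γ₂`, so here `ω₁ =
    -- ω₂` and `ϑ` is the point mass at `0`.
    refine ⟨γ₁, γ₂, ω, ω, g₁, g₂, hγ1, hγ2, hω, hω, HeydeLCA.z2Related_self rfl ω, ?_, ?_⟩
    · rw [← Measure.conv_assoc, ← hd1, HeydeLCA.map_sub_conv_dirac]
    · rw [← Measure.conv_assoc, ← hd2, HeydeLCA.map_sub_conv_dirac]
  · subst ha
    refine ⟨_, _, (0, 0, g₁), (0, 0, g₂),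
      Measure.isProbabilityMeasure_map (HeydeLCA.measurable_retractRZ2K _).aemeasurable,
      Measure.isProbabilityMeasure_map (HeydeLCA.measurable_retractRZ2K _).aemeasurable,
      HeydeLCA.z2Related_of_reduced (hneg μ₁ g₁ hchar₁) (hneg μ₂ g₂ hchar₂) hred hK1 hK2, ?_, ?_⟩
    · rw [HeydeLCA.ofRZ2K_map_retract hK1, HeydeLCA.map_sub_conv_dirac]
    · rw [HeydeLCA.ofRZ2K_map_retract hK2, HeydeLCA.map_sub_conv_dirac]
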